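/- Logarithms are to base $2$ and graphs are finite and simple. For a graph $G$, $F\subseteq E(G)$ and $U\subseteq V(G)$, let $N_{G-F}(U)$ be the set of vertices outside $U$ that are joined to a vertex of $U$ by an edge of $G$ not in $F$. An $n$-vertex graph $G$ is an $(\varepsilon,s)$-expander if $|N_{G-F}(U)|\ge \varepsilon|U|/(\log n)^2$ for all $U\subseteq V(G)$ and $F\subseteq E(G)$ with $1\le |U|\le \frac23 n$ and $|F|\le s|U|$. A set $V\subseteq V(G)$ is $D$-connecting in an $n$-vertex graph $G$ if for every sequence $x_1,\dots,x_r,y_1,\dots,y_r$ of (not necessarily distinct) vertices of $V(G)\setminus V$ such that each vertex of $V$ has at most $D$ neighbours, counted with multiplicity, in the multiset $\{x_1,\dots,x_r,y_1,\dots,y_r\}$, there are paths $P_1,\dots,P_r$ in $G$ such that $P_i$ joins $x_i$ and $y_i$, has length at most $(\log n)^6$ and has all its internal vertices in $V$, and no two of the paths share an internal vertex (if $x_i=y_i$, then $P_i$ is the trivial path of length $0$). **Lemma.** There is a function $f:\mathbb N\to\mathbb R$ with $f(n)\to0$ as $n\to\infty$ such that the following holds. Let $G$ be an $n$-vertex $(\varepsilon,s)$-expander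 with minimum degree $\delta$ and maximum degree $\Delta$, where $2^{-90}<\varepsilon<1$ and $s\ge p^{-4}(\log n)^{30}$ for some $p$ with $\frac{100\log n}{\delta}\le p\le 1$. Let $V$ be a $p$-random subset of $V(G)$, that is, each vertex is included in $V$ independently with probability $p$. Then, with probability at least $1-f(n)$, the set $V$ is $D$-connecting in $G$ for $$D=\frac{p^9 s\,\delta}{\Delta(\log n)^{73}}.$$ -/

import Mathlib

namespace SublinearExpander

open SimpleGraph

variable {V : Type*}

/-- `N_G(U)`: the vertices outside `U` that have a neighbour in `U`. -/
def extNeighbors (G : SimpleGraph V) (U : Finset V) : Set V :=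
  {v | v ∉ U ∧ ∃ u ∈ U, G.Adj u v}

/-- `(ε, s)`-expanders on `n = |V|` vertices; logarithms are to base 2. -/
def IsExpander [Fintype V] (G : SimpleGraph V) (ε s : ℝ) : Prop :=
  ∀ (U : Finset V) (F : Finset (Sym2 V)), (F : Set (Sym2 V)) ⊆ G.edgeSet →
    1 ≤ U.card → (U.card : ℝ) ≤ 2 / 3 * (Fintype.card V : ℝ) →
    (F.card : ℝ) ≤ s * (U.card : ℝ) →
    ε * (U.card : ℝ) / (Real.logb 2 (Fintype.card V : ℝ)) ^ 2 ≤
      ((extNeighbors (G.deleteEdges (F : Set (Sym2 V))) U).ncard : ℝ)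

/-- The vertices of a path other than its two endpoints. -/
def internalVertices {G : SimpleGraph V} {u v : V} (P : G.Walk u v) : Set V :=
  {w | w ∈ P.support ∧ w ≠ u ∧ w ≠ v}

/-- `S` is `D`-connecting in `G`. Indices count with multiplicity. Since the internal vertices lie
in `S` and the endpoints outside `S`, pairwise disjoint interiors also avoid all endpoints. For
`x i = y i` the only path is the trivial one, so such pairs impose no requirement. -/
def IsConnecting [Fintype V] (G : SimpleGraph V) (D : ℝ) (S : Set V) : Prop :=
  ∀ (r : ℕ) (x y : Fin r → V), (∀ i, x i ∉ S) → (∀ i, y i ∉ S) →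
    (∀ v ∈ S, (({i | G.Adj v (x i)}.ncard + {i | G.Adj v (y i)}.ncard : ℕ) : ℝ) ≤ D) →
    ∃ P : ∀ i, G.Walk (x i) (y i),
      (∀ i, (P i).IsPath ∧ internalVertices (P i) ⊆ S ∧
        ((P i).length : ℝ) ≤ (Real.logb 2 (Fintype.card V : ℝ)) ^ 6) ∧
      ∀ i j, i ≠ j → Disjoint (internalVertices (P i)) (internalVertices (P j))

end SublinearExpander

/-!
Write `l = log n`. A `p`-random set is the union of `N + 1 ≤ l ^ 5` independent `q`-random sets,
which are exposed one after the other. In one round of growth a set `B` acquires all neighbours of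
`B ∩ S` outside a small set `W` to be avoided, where `S` is a fresh random set. In an expander, a
set `B` with at most `3n/5` vertices sends to its outside a bipartite graph with bounded degrees and
many edges, and an exponential moment bound shows that a round multiplies `#B` by
`1 + ε / (8 * l ^ 2)` except with probability exponentially small in `#B`.

Consider the family of the neighbourhoods of a set `X` of terminals, with a large union. After a
phase of `L` rounds this union has very likely grown to `3n/5` vertices, so the sets grown from one
half of the family still have a large union, and the next phase starts from this half. After `log n`
halvings a single terminal reaches `3n/5` vertices, and the failure probability is small enough for
a union bound over all `X` and `W`. Two terminals that both reach `3n/5` vertices have `n/5` reached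
vertices in common, and one of these lies in the last random set and joins them.

Hence every subfamily of the pairs contains one that can be joined while a small set is avoided, and
Haxell's theorem on independent transversals yields disjoint paths for all pairs at once.
-/

namespace SublinearExpander

open Finset SimpleGraph

/-! ### Random subsets -/

section Bernoulli

variable {α ι : Type*} {q : ℝ}

/-- The expectation of `f` at a random subset of `B` that contains each element of `B`
independently with probability `q`. As a polynomial in `q` it makes sense for all real `q`. -/
def bernoulliExpect (q : ℝ) (B : Finset α) (f : Finset α → ℝ) : ℝ :=
  ∑ S ∈ B.powerset, q ^ #S * (1 - q) ^ (#B - #S) * f S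

lemma bernoulliExpect_empty (q : ℝ) (f : Finset α → ℝ) : bernoulliExpect q ∅ f = f ∅ := by
  simp [bernoulliExpect]

lemma bernoulliExpect_mono (hq : q ∈ Set.Icc (0 : ℝ) 1) {B : Finset α} {f g : Finset α → ℝ}
    (h : ∀ S ⊆ B, f S ≤ g S) : bernoulliExpect q B f ≤ bernoulliExpect q B g := by
  refine sum_le_sum fun S hS ↦ mul_le_mul_of_nonneg_left (h S (mem_powerset.1 hS)) ?_
  exact mul_nonneg (pow_nonneg hq.1 _) (pow_nonneg (sub_nonneg.2 hq.2) _)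

lemma bernoulliExpect_congr {B : Finset α} {f g : Finset α → ℝ} (h : ∀ S ⊆ B, f S = g S) :
    bernoulliExpect q B f = bernoulliExpect q B g :=
  sum_congr rfl fun S hS ↦ by rw [h S (mem_powerset.1 hS)]

lemma bernoulliExpect_add (q : ℝ) (B : Finset α) (f g : Finset α → ℝ) :
    bernoulliExpect q B (fun S ↦ f S + g S) = bernoulliExpect q B f + bernoulliExpect q B g := by
  simp [bernoulliExpect, mul_add, sum_add_distrib]

lemma bernoulliExpect_mul_left (q : ℝ) (B : Finset α) (c : ℝ) (f : Finset α → ℝ) :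
    bernoulliExpect q B (fun S ↦ c * f S) = c * bernoulliExpect q B f := by
  simp only [bernoulliExpect, mul_sum]
  exact sum_congr rfl fun S _ ↦ by ring

lemma bernoulliExpect_sum (q : ℝ) (B : Finset α) (t : Finset ι) (f : ι → Finset α → ℝ) :
    bernoulliExpect q B (fun S ↦ ∑ i ∈ t, f i S) = ∑ i ∈ t, bernoulliExpect q B (f i) := by
  simp only [bernoulliExpect, mul_sum]
  exact sum_comm

lemma bernoulliExpect_insert [DecidableEq α] (q : ℝ) {a : α} {B : Finset α} (ha : a ∉ B)
    (f : Finset α → ℝ) :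
    bernoulliExpect q (insert a B) f =
      (1 - q) * bernoulliExpect q B f + q * bernoulliExpect q B (fun S ↦ f (insert a S)) := by
  unfold bernoulliExpect
  rw [sum_powerset_insert ha, mul_sum, mul_sum]
  congr 1 <;> refine sum_congr rfl fun S hS ↦ ?_
  · rw [card_insert_of_notMem ha, Nat.sub_add_comm (card_le_card (mem_powerset.1 hS)), pow_succ]
    ring
  · rw [card_insert_of_notMem ha, card_insert_of_notMem fun h ↦ ha (mem_powerset.1 hS h),
      Nat.add_sub_add_right, pow_succ]
    ring

lemma bernoulliExpect_const (q : ℝ) (B : Finset α) (c : ℝ) :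
    bernoulliExpect q B (fun _ ↦ c) = c := by
  classical
  induction B using Finset.induction_on with
  | empty => exact bernoulliExpect_empty _ _
  | insert a B ha ih => rw [bernoulliExpect_insert q ha, ih]; ring

lemma bernoulliExpect_union [DecidableEq α] (a b : ℝ) (B : Finset α) (f : Finset α → ℝ) :
    bernoulliExpect (1 - (1 - a) * (1 - b)) B f =
      bernoulliExpect a B (fun S ↦ bernoulliExpect b B (fun T ↦ f (S ∪ T))) := by
  induction B using Finset.induction_on generalizing f with
  | empty => simp [bernoulliExpect_empty]
  | insert c B hc ih =>
    simp only [bernoulliExpect_insert _ hc, bernoulliExpect_add, bernoulliExpect_mul_left,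
      insert_union, union_insert, insert_idem]
    rw [ih, ih]
    ring

lemma bernoulliExpect_disjoint [DecidableEq α] (q : ℝ) {A B : Finset α} (h : A ⊆ B) :
    bernoulliExpect q B (fun S ↦ if Disjoint A S then 1 else 0) = (1 - q) ^ #A := by
  induction B using Finset.induction_on generalizing A with
  | empty => obtain rfl := subset_empty.1 h; simp [bernoulliExpect_empty]
  | insert c B hc ih =>
    rw [bernoulliExpect_insert _ hc]
    by_cases hA : c ∈ A
    · have hit : bernoulliExpect q B (fun S ↦ if Disjoint A (insert c S) then 1 else 0) = 0 := by
        simp [disjoint_insert_right, hA, bernoulliExpect_const]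
      have miss : bernoulliExpect q B (fun S ↦ if Disjoint A S then 1 else 0) =
          (1 - q) ^ #(A.erase c) := by
        rw [← ih (subset_insert_iff.1 h)]
        refine bernoulliExpect_congr fun S hS ↦ ?_
        have hcS : c ∉ S := fun h ↦ hc (hS h)
        conv_lhs => rw [← insert_erase hA]
        simp [disjoint_insert_left, hcS]
      rw [hit, miss, ← card_erase_add_one hA, pow_succ]
      ring
    · simp only [disjoint_insert_right, hA, not_false_eq_true, true_and]
      rw [ih ((subset_insert_iff_of_notMem hA).1 h)]
      ring

lemma bernoulliExpect_card_filter_not_disjoint [DecidableEq α] (q : ℝ) (t : Finset ι)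
    {A : ι → Finset α} {B : Finset α} (h : ∀ i ∈ t, A i ⊆ B) :
    bernoulliExpect q B (fun S ↦ (#{i ∈ t | ¬ Disjoint (A i) S} : ℝ)) =
      ∑ i ∈ t, (1 - (1 - q) ^ #(A i)) := by
  have card_eq (S : Finset α) : (#{i ∈ t | ¬ Disjoint (A i) S} : ℝ) =
      ∑ i ∈ t, (1 + -1 * if Disjoint (A i) S then (1 : ℝ) else 0) := by
    rw [card_filter, Nat.cast_sum]
    exact sum_congr rfl fun i _ ↦ by split_ifs <;> simp_all
  simp only [card_eq, bernoulliExpect_sum, bernoulliExpect_add, bernoulliExpect_const,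
    bernoulliExpect_mul_left]
  exact sum_congr rfl fun i hi ↦ by rw [bernoulliExpect_disjoint q (h i hi)]; ring

lemma exp_neg_le_one_sub_half {y : ℝ} (h0 : 0 ≤ y) (h1 : y ≤ 1) :
    Real.exp (-y) ≤ 1 - y / 2 := by
  rw [Real.exp_neg, inv_le_comm₀ (Real.exp_pos _) (by linarith)]
  refine le_trans ?_ (Real.quadratic_le_exp_of_nonneg h0)
  rw [inv_le_iff_one_le_mul₀ (by linarith)]
  nlinarith [mul_nonneg h0 (sub_nonneg.2 h1), mul_nonneg h0 (mul_nonneg h0 (sub_nonneg.2 h1))]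

lemma one_sub_add_mul_exp_neg_le {y : ℝ} (hq : 0 ≤ q) (h0 : 0 ≤ y) (h1 : y ≤ 1) :
    1 - q + q * Real.exp (-y) ≤ Real.exp (-(q / 2 * y)) := by
  have := mul_le_mul_of_nonneg_left (exp_neg_le_one_sub_half h0 h1) hq
  linarith [Real.one_sub_le_exp_neg (q / 2 * y)]

lemma bernoulliExpect_exp_neg_le [DecidableEq α] (hq : q ∈ Set.Icc (0 : ℝ) 1) (B : Finset α)
    (f : Finset α → ℝ) (hmono : ∀ S a, f S ≤ f (insert a S))
    (hinc : ∀ S a, f (insert a S) ≤ f S + 1) :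
    bernoulliExpect q B (fun S ↦ Real.exp (-f S)) ≤ Real.exp (-bernoulliExpect (q / 2) B f) := by
  induction B using Finset.induction_on generalizing f with
  | empty => simp [bernoulliExpect_empty]
  | insert c B hc ih =>
    -- Averaging out the membership of `c` at density `q / 2` keeps the increments in `[0, 1]`.
    set g : Finset α → ℝ := fun S ↦ (1 - q / 2) * f S + q / 2 * f (insert c S) with hg
    have g_le S : (1 - q) * Real.exp (-f S) + q * Real.exp (-f (insert c S)) ≤
        Real.exp (-g S) := by
      obtain ⟨y, hy⟩ : ∃ y, f (insert c S) = f S + y := ⟨_, (add_sub_cancel _ _).symm⟩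
      have key := one_sub_add_mul_exp_neg_le (y := y) hq.1
        (by linarith [hmono S c]) (by linarith [hinc S c])
      calc (1 - q) * Real.exp (-f S) + q * Real.exp (-f (insert c S))
          = Real.exp (-f S) * (1 - q + q * Real.exp (-y)) := by
            rw [hy, neg_add, Real.exp_add]; ring
        _ ≤ Real.exp (-f S) * Real.exp (-(q / 2 * y)) := by gcongr
        _ = Real.exp (-g S) := by simp only [← Real.exp_add, hg, hy]; ring_nf
    calc bernoulliExpect q (insert c B) (fun S ↦ Real.exp (-f S))
        = bernoulliExpect q B
            (fun S ↦ (1 - q) * Real.exp (-f S) + q * Real.exp (-f (insert c S))) := by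
          rw [bernoulliExpect_insert _ hc, bernoulliExpect_add, bernoulliExpect_mul_left,
            bernoulliExpect_mul_left]
      _ ≤ bernoulliExpect q B (fun S ↦ Real.exp (-g S)) := bernoulliExpect_mono hq fun S _ ↦ g_le S
      _ ≤ Real.exp (-bernoulliExpect (q / 2) B g) := by
          refine ih g (fun S a ↦ ?_) fun S a ↦ ?_ <;> simp only [hg, insert_comm c a]
          · nlinarith [hmono S a, hmono (insert c S) a, hq.1, hq.2]
          · nlinarith [hinc S a, hinc (insert c S) a, hq.1, hq.2]
      _ = Real.exp (-bernoulliExpect (q / 2) (insert c B) f) := by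
          rw [bernoulliExpect_insert _ hc, bernoulliExpect_add, bernoulliExpect_mul_left,
            bernoulliExpect_mul_left]

variable [Fintype α]

open Classical in
/-- The probability that a random subset of `α` of density `q` has the property `P`. -/
noncomputable def bernoulliProb (q : ℝ) (P : Finset α → Prop) : ℝ :=
  bernoulliExpect q univ (fun S ↦ if P S then 1 else 0)

lemma bernoulliProb_mono (hq : q ∈ Set.Icc (0 : ℝ) 1) {P R : Finset α → Prop}
    (h : ∀ S, P S → R S) : bernoulliProb q P ≤ bernoulliProb q R := by
  refine bernoulliExpect_mono hq fun S _ ↦ ?_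
  by_cases hP : P S
  · simp [hP, h S hP]
  · rw [if_neg hP]
    positivity

lemma bernoulliProb_eq_zero (q : ℝ) {P : Finset α → Prop} (h : ∀ S, ¬ P S) :
    bernoulliProb q P = 0 := by
  simp only [bernoulliProb, h, if_false, bernoulliExpect_const]

lemma bernoulliProb_le_one (hq : q ∈ Set.Icc (0 : ℝ) 1) (P : Finset α → Prop) :
    bernoulliProb q P ≤ 1 := by
  refine (bernoulliExpect_mono hq fun S _ ↦ ?_).trans (bernoulliExpect_const q univ 1).le
  split_ifs <;> norm_num

lemma bernoulliProb_not (q : ℝ) (P : Finset α → Prop) :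
    bernoulliProb q (fun S ↦ ¬ P S) = 1 - bernoulliProb q P := by
  rw [eq_sub_iff_add_eq, bernoulliProb, bernoulliProb, ← bernoulliExpect_add]
  refine (bernoulliExpect_congr fun S _ ↦ ?_).trans (bernoulliExpect_const q univ 1)
  by_cases hP : P S <;> simp [hP]

lemma bernoulliProb_or_le (hq : q ∈ Set.Icc (0 : ℝ) 1) (P R : Finset α → Prop) :
    bernoulliProb q (fun S ↦ P S ∨ R S) ≤ bernoulliProb q P + bernoulliProb q R := by
  rw [bernoulliProb, bernoulliProb, bernoulliProb, ← bernoulliExpect_add]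
  refine bernoulliExpect_mono hq fun S _ ↦ ?_
  by_cases hP : P S <;> by_cases hR : R S <;> simp [hP, hR]

lemma bernoulliProb_exists_le_sum [Fintype ι] (hq : q ∈ Set.Icc (0 : ℝ) 1)
    {P : ι → Finset α → Prop} {c : ι → ℝ} (h : ∀ i, bernoulliProb q (P i) ≤ c i) :
    bernoulliProb q (fun S ↦ ∃ i, P i S) ≤ ∑ i, c i := by
  classical
  refine le_trans ?_ (sum_le_sum fun i _ ↦ h i)
  simp only [bernoulliProb, ← bernoulliExpect_sum]
  refine bernoulliExpect_mono hq fun S _ ↦ ?_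
  split_ifs with hS
  · obtain ⟨i, hi⟩ := hS
    refine le_trans (by rw [if_pos hi])
      (single_le_sum (f := fun i ↦ if P i S then (1 : ℝ) else 0) (fun j _ ↦ by positivity)
        (mem_univ i))
  · positivity

lemma bernoulliProb_and_le {A : Prop} {P : Finset α → Prop} {c : ℝ} (hc : 0 ≤ c)
    (h : A → bernoulliProb q P ≤ c) : bernoulliProb q (fun S ↦ A ∧ P S) ≤ c := by
  by_cases hA : A
  · simpa only [hA, true_and] using h hA
  · rw [bernoulliProb_eq_zero q fun S hS ↦ hA hS.1]
    exact hc

lemma bernoulliProb_union_le [DecidableEq α] {a b c : ℝ} (ha : a ∈ Set.Icc (0 : ℝ) 1)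
    (hb : b ∈ Set.Icc (0 : ℝ) 1) (hc : 0 ≤ c) {P R : Finset α → Prop}
    {Q : Finset α → Finset α → Prop} (hR : ∀ S T, R (S ∪ T) → P S ∨ Q S T)
    (hQ : ∀ S, ¬ P S → bernoulliProb b (Q S) ≤ c) :
    bernoulliProb (1 - (1 - a) * (1 - b)) R ≤ bernoulliProb a P + c := by
  classical
  rw [bernoulliProb, bernoulliProb, bernoulliExpect_union,
    ← bernoulliExpect_const a (univ : Finset α) c, ← bernoulliExpect_add]
  refine bernoulliExpect_mono ha fun S _ ↦ ?_
  split_ifs with hP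
  · linarith [bernoulliProb_le_one hb fun T ↦ R (S ∪ T), bernoulliProb.eq_def b fun T ↦ R (S ∪ T)]
  · rw [zero_add]
    exact (bernoulliProb_mono hb fun T hT ↦ (hR S T hT).resolve_left hP).trans (hQ S hP)

lemma bernoulliProb_lt_le_exp [DecidableEq α] (hq : q ∈ Set.Icc (0 : ℝ) 1) {f : Finset α → ℝ}
    (hmono : ∀ S a, f S ≤ f (insert a S)) (hinc : ∀ S a, f (insert a S) ≤ f S + 1) (t : ℝ) :
    bernoulliProb q (fun S ↦ f S < t) ≤ Real.exp (t - bernoulliExpect (q / 2) univ f) := by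
  rw [sub_eq_add_neg, Real.exp_add]
  refine le_trans ?_ (mul_le_mul_of_nonneg_left (bernoulliExpect_exp_neg_le hq univ f hmono hinc)
    (Real.exp_pos t).le)
  rw [← bernoulliExpect_mul_left]
  refine bernoulliExpect_mono hq fun S _ ↦ ?_
  rw [← Real.exp_add]
  split_ifs with h
  · exact Real.one_le_exp (by linarith)
  · positivity

lemma bernoulliProb_card_filter_not_disjoint_lt_le [DecidableEq α] (hq : q ∈ Set.Icc (0 : ℝ) 1)
    (t : Finset ι) (A : ι → Finset α) {D : ℕ} (hD : 0 < D)
    (hA : ∀ a, #{i ∈ t | a ∈ A i} ≤ D) (y : ℝ) :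
    bernoulliProb q (fun S ↦ (#{i ∈ t | ¬ Disjoint (A i) S} : ℝ) < D * y) ≤
      Real.exp (y - (∑ i ∈ t, (1 - (1 - q / 2) ^ #(A i))) / D) := by
  classical
  have hD' : (0 : ℝ) < D := by exact_mod_cast hD
  have hits_insert S a : ({i ∈ t | ¬ Disjoint (A i) (insert a S)} : Finset ι) =
      {i ∈ t | ¬ Disjoint (A i) S} ∪ {i ∈ t | a ∈ A i} := by
    ext i
    simp only [mem_filter, mem_union, disjoint_insert_right]
    tauto
  have key := bernoulliProb_lt_le_exp hq
    (f := fun S ↦ (D : ℝ)⁻¹ * #{i ∈ t | ¬ Disjoint (A i) S})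
    (fun S a ↦ by rw [hits_insert]; gcongr; exact subset_union_left)
    (fun S a ↦ by
      rw [← inv_mul_cancel₀ hD'.ne', ← mul_add, hits_insert]
      gcongr
      exact_mod_cast (card_union_le _ _).trans (Nat.add_le_add_left (hA a) _)) y
  rw [bernoulliExpect_mul_left,
    bernoulliExpect_card_filter_not_disjoint _ _ fun i _ ↦ subset_univ (A i)] at key
  simpa only [inv_mul_lt_iff₀ hD', inv_mul_eq_div (D : ℝ) (∑ _ ∈ t, _)] using key

lemma bernoulliProb_card_inter_lt_le [DecidableEq α] (hq : q ∈ Set.Icc (0 : ℝ) 1) (B : Finset α)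
    (t : ℝ) : bernoulliProb q (fun S ↦ (#(B ∩ S) : ℝ) < t) ≤ Real.exp (t - q / 2 * #B) := by
  have key := bernoulliProb_card_filter_not_disjoint_lt_le hq B (fun b ↦ {b}) one_pos
    (fun a ↦ card_le_one.2 fun i hi j hj ↦ by
      simp only [mem_filter, mem_singleton] at hi hj
      exact hi.2.symm.trans hj.2) t
  simpa [filter_mem_eq_inter, mul_comm] using key

lemma one_sub_one_sub_pow_mem_Icc (hq : q ∈ Set.Icc (0 : ℝ) 1) (k : ℕ) :
    1 - (1 - q) ^ k ∈ Set.Icc (0 : ℝ) 1 := by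
  have h := sub_nonneg.2 hq.2
  exact ⟨sub_nonneg.2 (pow_le_one₀ h (by linarith [hq.1])), by linarith [pow_nonneg h k]⟩

lemma bernoulliProb_union_pow_le [DecidableEq α] (hq : q ∈ Set.Icc (0 : ℝ) 1) (k m : ℕ) {c : ℝ}
    (hc : 0 ≤ c) {P R : Finset α → Prop} {Q : Finset α → Finset α → Prop}
    (hR : ∀ S T, R (S ∪ T) → P S ∨ Q S T)
    (hQ : ∀ S, ¬ P S → bernoulliProb (1 - (1 - q) ^ m) (Q S) ≤ c) :
    bernoulliProb (1 - (1 - q) ^ (k + m)) R ≤ bernoulliProb (1 - (1 - q) ^ k) P + c := by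
  have hdensity : 1 - (1 - q) ^ (k + m) =
      1 - (1 - (1 - (1 - q) ^ k)) * (1 - (1 - (1 - q) ^ m)) := by ring
  rw [hdensity]
  exact bernoulliProb_union_le (one_sub_one_sub_pow_mem_Icc hq k) (one_sub_one_sub_pow_mem_Icc hq m)
    hc hR hQ

end Bernoulli

/-! ### Disjoint representatives -/

section Representatives

variable {ι α : Type*} {E : ι → Set (Finset α)} {J C C' : Finset ι} {W W' e e' : Finset α}
  {M M' : ι → Finset α} {k : ℕ}

/-- `M` selects pairwise disjoint members of the families `E j` with `j ∈ J`. The values of `M`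
outside `J` are irrelevant. -/
structure IsSystem (E : ι → Set (Finset α)) (J : Finset ι) (M : ι → Finset α) : Prop where
  mem : ∀ j ∈ J, M j ∈ E j
  pairwiseDisjoint : ∀ i ∈ J, ∀ j ∈ J, i ≠ j → Disjoint (M i) (M j)

/-- A system whose members with index in `C` lie inside `W` and whose other members avoid `W`: the
state of the search for a member of some `E c`, `c ∈ C`, that can be freed by rearranging the
system outside `C`. -/
structure IsSplit (E : ι → Set (Finset α)) (J C : Finset ι) (W : Finset α)
    (M : ι → Finset α) : Prop extends IsSystem E J M where
  subset : ∀ j ∈ J, j ∈ C → M j ⊆ W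
  disjoint : ∀ j ∈ J, j ∉ C → Disjoint (M j) W

open Classical in
/-- The indices of the members of a system that meet `e`. -/
noncomputable def blockers (J : Finset ι) (M : ι → Finset α) (e : Finset α) : Finset ι :=
  {j ∈ J | ¬ Disjoint e (M j)}

lemma mem_blockers {j : ι} : j ∈ blockers J M e ↔ j ∈ J ∧ ¬ Disjoint e (M j) := by
  simp [blockers]

lemma disjoint_of_notMem_blockers {j : ι} (hj : j ∈ J) (h : j ∉ blockers J M e) :
    Disjoint e (M j) :=
  not_not.1 fun h' ↦ h (mem_blockers.2 ⟨hj, h'⟩)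

lemma IsSplit.disjoint_blockers (h : IsSplit E J C W M) (he : Disjoint e W) :
    Disjoint C (blockers J M e) := by
  refine disjoint_left.2 fun j hjC hj ↦ ?_
  obtain ⟨hjJ, hmeet⟩ := mem_blockers.1 hj
  exact hmeet (he.mono_right (h.subset j hjJ hjC))

lemma IsSplit.restrict (h : IsSplit E J C W M) (h' : IsSplit E J C' W' M') (hC : C ⊆ C')
    (hW : W ⊆ W') (hM : ∀ j ∈ C', M' j = M j) : IsSplit E J C W M' where
  toIsSystem := h'.toIsSystem
  subset j hj hjC := hM j (hC hjC) ▸ h.subset j hj hjC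
  disjoint j hj hjC := by
    by_cases hjC' : j ∈ C'
    · exact hM j hjC' ▸ h.disjoint j hj hjC
    · exact (h'.disjoint j hj hjC').mono_right hW

section DecidableEq

variable [DecidableEq ι]

lemma IsSplit.sdiff_union_blockers_ssubset (h : IsSplit E J C W M) (he : Disjoint e W)
    (hne : (blockers J M e).Nonempty) : J \ (C ∪ blockers J M e) ⊂ J \ C := by
  refine ⟨sdiff_subset_sdiff le_rfl subset_union_left, fun hle ↦ ?_⟩
  obtain ⟨j, hj⟩ := hne
  have hjC := disjoint_right.1 (h.disjoint_blockers he) hj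
  exact (mem_sdiff.1 (hle (mem_sdiff.2 ⟨(mem_blockers.1 hj).1, hjC⟩))).2 (mem_union_right _ hj)

lemma IsSystem.update (h : IsSystem E J M) {c : ι} (he : e ∈ E c) (hfree : blockers J M e = ∅) :
    IsSystem E (insert c J) (Function.update M c e) := by
  have disj j (hj : j ∈ J) : Disjoint e (M j) := disjoint_of_notMem_blockers hj (by simp [hfree])
  refine ⟨fun j hj ↦ ?_, fun i hi j hj hij ↦ ?_⟩
  · obtain rfl | hjc := eq_or_ne j c
    · simpa using he
    · simpa [hjc] using h.mem j (mem_of_mem_insert_of_ne hj hjc)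
  · obtain rfl | hic := eq_or_ne i c
    · simpa [hij.symm] using disj j (mem_of_mem_insert_of_ne hj hij.symm)
    obtain rfl | hjc := eq_or_ne j c
    · simpa [hij] using (disj i (mem_of_mem_insert_of_ne hi hij)).symm
    · simpa [hic, hjc] using h.pairwiseDisjoint i (mem_of_mem_insert_of_ne hi hic) j
        (mem_of_mem_insert_of_ne hj hjc) hij

lemma IsSplit.update (h : IsSplit E J C W M) {c : ι} (hcJ : c ∈ J) (hcC : c ∉ C) (he : e ∈ E c)
    (heW : Disjoint e W) (hfree : blockers J M e = ∅) :
    IsSplit E J C W (Function.update M c e) where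
  toIsSystem := by simpa [hcJ] using h.toIsSystem.update he hfree
  subset j hj hjC := by
    rw [Function.update_of_ne (ne_of_mem_of_not_mem hjC hcC)]
    exact h.subset j hj hjC
  disjoint j hj hjC := by
    obtain rfl | hjc := eq_or_ne j c
    · simpa using heW
    · simpa [hjc] using h.disjoint j hj hjC

lemma blockers_update_subset {c : ι} (hee' : Disjoint e e') :
    blockers J (Function.update M c e') e ⊆ (blockers J M e).erase c := by
  intro j hj
  obtain ⟨hjJ, hmeet⟩ := mem_blockers.1 hj
  obtain rfl | hjc := eq_or_ne j c
  · exact absurd hee' (by simpa using hmeet)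
  · rw [Function.update_of_ne hjc] at hmeet
    exact mem_erase.2 ⟨hjc, mem_blockers.2 ⟨hjJ, hmeet⟩⟩

lemma IsSplit.blockers_subset (h : IsSplit E J C W M)
    (h' : IsSplit E J (C ∪ blockers J M e) W' M') (heW : Disjoint e W) (heW' : e ⊆ W')
    (hM : ∀ j ∈ C, M' j = M j) : blockers J M' e ⊆ blockers J M e := by
  intro j hj
  obtain ⟨hjJ, hmeet⟩ := mem_blockers.1 hj
  by_contra hjA
  by_cases hjC : j ∈ C
  · exact hmeet (hM j hjC ▸ heW.mono_right (h.subset j hjJ hjC))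
  · exact hmeet ((h'.disjoint j hjJ (by simp [hjC, hjA])).mono_right heW').symm

variable [DecidableEq α]

lemma IsSplit.absorb_blockers (h : IsSplit E J C W M) (e : Finset α) :
    IsSplit E J (C ∪ blockers J M e) (W ∪ (e ∪ (blockers J M e).biUnion M)) M where
  toIsSystem := h.toIsSystem
  subset j hj hjCA := by
    rcases mem_union.1 hjCA with hjC | hjA
    · exact (h.subset j hj hjC).trans subset_union_left
    · exact (subset_biUnion_of_mem M hjA).trans (subset_union_right.trans subset_union_right)
  disjoint j hj hjCA := by
    rw [mem_union, not_or] at hjCA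
    simp only [disjoint_union_right, disjoint_biUnion_right]
    exact ⟨h.disjoint j hj hjCA.1, (disjoint_of_notMem_blockers hj hjCA.2).symm, fun i hi ↦
      h.pairwiseDisjoint j hj i (mem_blockers.1 hi).1 (ne_of_mem_of_not_mem hi hjCA.2).symm⟩

lemma IsSplit.card_absorb_blockers_le (h : IsSplit E J C W M) (hk : ∀ i, ∀ e ∈ E i, #e ≤ k)
    (hW : #W ≤ 2 * k * #C) (heW : Disjoint e W) (hek : #e ≤ k)
    (hne : (blockers J M e).Nonempty) :
    #(W ∪ (e ∪ (blockers J M e).biUnion M)) ≤ 2 * k * #(C ∪ blockers J M e) := by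
  have hunion : #((blockers J M e).biUnion M) ≤ #(blockers J M e) * k :=
    card_biUnion_le_card_mul _ _ _ fun j hj ↦ hk j _ (h.mem j (mem_blockers.1 hj).1)
  have hk_le : k ≤ #(blockers J M e) * k := Nat.le_mul_of_pos_left k hne.card_pos
  calc #(W ∪ (e ∪ (blockers J M e).biUnion M))
      ≤ #W + (#e + #((blockers J M e).biUnion M)) :=
        (card_union_le _ _).trans (Nat.add_le_add_left (card_union_le _ _) _)
    _ ≤ 2 * k * #C + (#(blockers J M e) * k + #(blockers J M e) * k) := by omega
    _ = 2 * k * #(C ∪ blockers J M e) := by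
        rw [card_union_of_disjoint (h.disjoint_blockers heW)]
        ring

end DecidableEq

lemma IsSplit.exists_free (hk : ∀ i, ∀ e ∈ E i, #e ≤ k)
    (hE : ∀ I : Finset ι, I.Nonempty → ∀ W : Finset α, #W ≤ 2 * k * #I →
      ∃ i ∈ I, ∃ e ∈ E i, Disjoint e W)
    (h : IsSplit E J C W M) (hC : C.Nonempty) (hW : #W ≤ 2 * k * #C) :
    ∃ M', IsSplit E J C W M' ∧ (∀ j ∈ C, M' j = M j) ∧
      ∃ c ∈ C, ∃ e ∈ E c, Disjoint e W ∧ blockers J M' e = ∅ := by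
  classical
  induction hm : #(J \ C) using Nat.strong_induction_on generalizing C W M with
  | _ m ih =>
  obtain ⟨c, hc, e, he, heW⟩ := hE C hC W hW
  obtain ⟨M₁, ⟨h₁, hM₁⟩, hmin⟩ := exists_minimalFor_of_wellFoundedLT
    (fun M₁ ↦ IsSplit E J C W M₁ ∧ ∀ j ∈ C, M₁ j = M j) (fun M₁ ↦ #(blockers J M₁ e))
    ⟨M, h, fun _ _ ↦ rfl⟩
  obtain hA | hA := (blockers J M₁ e).eq_empty_or_nonempty
  · exact ⟨M₁, h₁, hM₁, c, hc, e, he, heW, hA⟩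
  set A := blockers J M₁ e
  obtain ⟨M', h', hM', c', hc', e', he', he'W, hfree⟩ := ih _
    (hm ▸ card_lt_card (h₁.sdiff_union_blockers_ssubset heW hA))
    (h₁.absorb_blockers e) (hC.mono subset_union_left)
    (h₁.card_absorb_blockers_le hk hW heW (hk c e he) hA) rfl
  simp only [disjoint_union_right] at he'W
  have h'' : IsSplit E J C W M' := h₁.restrict h' subset_union_left subset_union_left hM'
  have hM'C j (hj : j ∈ C) : M' j = M₁ j := hM' j (mem_union_left _ hj)
  obtain hc'C | hc'A := mem_union.1 hc'
  · exact ⟨M', h'', fun j hj ↦ (hM'C j hj).trans (hM₁ j hj), c', hc'C, e', he', he'W.1, hfree⟩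
  -- Moving `c'` to `e'` unblocks `e` at `c'`, against the minimal choice of `M₁`.
  have hc'C : c' ∉ C := disjoint_right.1 (h₁.disjoint_blockers heW) hc'A
  refine absurd (hmin ⟨h''.update (mem_blockers.1 hc'A).1 hc'C he' he'W.1 hfree, fun j hj ↦ ?_⟩) ?_
  · rw [Function.update_of_ne (ne_of_mem_of_not_mem hj hc'C), hM'C j hj, hM₁ j hj]
  have hlt : #(blockers J (Function.update M' c' e') e) < #A :=
    (card_le_card ((blockers_update_subset he'W.2.1.symm).trans
      (erase_subset_erase c' (h₁.blockers_subset h' heW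
        (subset_union_left.trans subset_union_right) hM'C)))).trans_lt (card_erase_lt_of_mem hc'A)
  exact fun hle ↦ (hle hlt.le).not_gt hlt

/-- **Haxell's theorem** on independent transversals, for families of sets of size at most `k`. -/
theorem exists_pairwise_disjoint_representatives [Finite ι] (hk : ∀ i, ∀ e ∈ E i, #e ≤ k)
    (hE : ∀ I : Finset ι, I.Nonempty → ∀ W : Finset α, #W ≤ 2 * k * #I →
      ∃ i ∈ I, ∃ e ∈ E i, Disjoint e W) :
    ∃ M : ι → Finset α, (∀ i, M i ∈ E i) ∧ ∀ i j, i ≠ j → Disjoint (M i) (M j) := by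
  classical
  cases nonempty_fintype ι
  suffices exists_system : ∀ J : Finset ι, ∃ M, IsSystem E J M by
    obtain ⟨M, hM⟩ := exists_system univ
    exact ⟨M, fun i ↦ hM.mem i (mem_univ i),
      fun i j ↦ hM.pairwiseDisjoint i (mem_univ i) j (mem_univ j)⟩
  intro J
  induction J using Finset.induction_on with
  | empty => exact ⟨fun _ ↦ ∅, by simp, by simp⟩
  | insert a J ha ih =>
    obtain ⟨M, hM⟩ := ih
    have hsplit : IsSplit E J {a} ∅ M :=
      ⟨hM, fun j hj hja ↦ absurd (mem_singleton.1 hja ▸ hj) ha, by simp⟩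
    obtain ⟨M', hM', -, c, hc, e, he, -, hfree⟩ :=
      hsplit.exists_free hk hE (singleton_nonempty a) (by simp)
    obtain rfl := mem_singleton.1 hc
    exact ⟨_, hM'.toIsSystem.update he hfree⟩

end Representatives

/-! ### Sparse cuts in expanders -/

section SparseCut

variable {V : Type*} [DecidableEq V] {G : SimpleGraph V} {B W : Finset V} {D d : ℕ}
  {H : Finset (V × V)}

/-- A bipartite subgraph of `G` between `B` and the vertices outside `B ∪ W`, given by its edges
directed away from `B`, with degrees at most `D` in `B` and at most `d` outside. -/
structure IsSparseCut (G : SimpleGraph V) (B W : Finset V) (D d : ℕ) (H : Finset (V × V)) :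
    Prop where
  fst_mem : ∀ e ∈ H, e.1 ∈ B
  snd_notMem : ∀ e ∈ H, e.2 ∉ B
  snd_notMem_deleted : ∀ e ∈ H, e.2 ∉ W
  adj : ∀ e ∈ H, G.Adj e.1 e.2
  card_fst_le : ∀ u, #{e ∈ H | e.1 = u} ≤ D
  card_snd_le : ∀ v, #{e ∈ H | e.2 = v} ≤ d

lemma IsSparseCut.insert (hH : IsSparseCut G B W D d H) {u v : V} (hu : u ∈ B) (hv : v ∉ B)
    (hvW : v ∉ W) (huv : G.Adj u v) (hu_lt : #{e ∈ H | e.1 = u} ≠ D)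
    (hv_lt : #{e ∈ H | e.2 = v} ≠ d) : IsSparseCut G B W D d (insert (u, v) H) where
  fst_mem := forall_mem_insert _ _ _ |>.2 ⟨hu, hH.fst_mem⟩
  snd_notMem := forall_mem_insert _ _ _ |>.2 ⟨hv, hH.snd_notMem⟩
  snd_notMem_deleted := forall_mem_insert _ _ _ |>.2 ⟨hvW, hH.snd_notMem_deleted⟩
  adj := forall_mem_insert _ _ _ |>.2 ⟨huv, hH.adj⟩
  card_fst_le x := by
    rw [filter_insert]
    split_ifs with hx
    · subst hx
      exact (card_insert_le _ _).trans (lt_of_le_of_ne (hH.card_fst_le u) hu_lt)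
    · exact hH.card_fst_le x
  card_snd_le x := by
    rw [filter_insert]
    split_ifs with hx
    · subst hx
      exact (card_insert_le _ _).trans (lt_of_le_of_ne (hH.card_snd_le v) hv_lt)
    · exact hH.card_snd_le x

lemma mul_card_filter_card_fiber_eq_le {α β : Type*} [Fintype α] [DecidableEq α] (f : β → α)
    (H : Finset β) (m : ℕ) : m * #{a | #{b ∈ H | f b = a} = m} ≤ #H :=
  calc m * #{a | #{b ∈ H | f b = a} = m}
      = ∑ a with #{b ∈ H | f b = a} = m, #{b ∈ H | f b = a} := by
        rw [sum_congr rfl fun a ha ↦ (mem_filter.1 ha).2, sum_const, smul_eq_mul, mul_comm]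
    _ ≤ ∑ a, #{b ∈ H | f b = a} := sum_le_sum_of_subset (subset_univ _)
    _ = #H := (card_eq_sum_card_fiberwise fun _ _ ↦ mem_coe.2 (mem_univ _)).symm

variable [Fintype V] [DecidableRel G.Adj]

variable (G) in
/-- The edges in `H` and all edges at the vertices of `C`. Deleting them confines expansion to
edges outside `H` that avoid `C`. -/
def edgesAt (C : Finset V) (H : Finset (V × V)) : Finset (Sym2 V) :=
  H.image (fun e ↦ s(e.1, e.2)) ∪ C.biUnion (fun v ↦ G.incidenceFinset v)

lemma coe_edgesAt_subset (C : Finset V) (hH : ∀ e ∈ H, G.Adj e.1 e.2) :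
    (edgesAt G C H : Set (Sym2 V)) ⊆ G.edgeSet := by
  intro e he
  rcases mem_union.1 (mem_coe.1 he) with he | he
  · obtain ⟨x, hx, rfl⟩ := mem_image.1 he
    exact hH x hx
  · obtain ⟨x, -, hx⟩ := mem_biUnion.1 he
    exact G.incidenceSet_subset x (by simpa using hx)

lemma card_edgesAt_le (C : Finset V) (H : Finset (V × V)) :
    #(edgesAt G C H) ≤ #H + #C * G.maxDegree := by
  refine (card_union_le _ _).trans (add_le_add card_image_le ?_)
  refine card_biUnion_le_card_mul _ _ _ fun v _ ↦ ?_
  rw [G.card_incidenceFinset_eq_degree]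
  exact G.degree_le_maxDegree v

lemma adj_of_deleteEdges_edgesAt_adj {C : Finset V} {u v : V}
    (h : (G.deleteEdges (edgesAt G C H : Set (Sym2 V))).Adj u v) :
    G.Adj u v ∧ (u, v) ∉ H ∧ u ∉ C ∧ v ∉ C := by
  rw [deleteEdges_adj, mem_coe, edgesAt, mem_union, not_or] at h
  obtain ⟨huv, hH, hC⟩ := h
  have incident x (hx : x = u ∨ x = v) : x ∉ C := fun hxC ↦
    hC (mem_biUnion.2 ⟨x, hxC, by rw [mem_incidenceFinset]; exact ⟨huv, by simpa using hx⟩⟩)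
  exact ⟨huv, fun h ↦ hH (mem_image_of_mem _ h), incident u (.inl rfl), incident v (.inr rfl)⟩

lemma extNeighbors_deleteEdges_edgesAt_subset (hH : Maximal (IsSparseCut G B W D d) H) :
    extNeighbors (G.deleteEdges
      (edgesAt G (W ∪ ({u | #{e ∈ H | e.1 = u} = D} : Finset V)) H : Set (Sym2 V))) B ⊆
      ({v | #{e ∈ H | e.2 = v} = d} : Finset V) := by
  rintro v ⟨hvB, u, huB, huv⟩
  obtain ⟨hadj, huvH, hu, hv⟩ := adj_of_deleteEdges_edgesAt_adj huv
  simp only [mem_union, not_or, mem_filter, mem_univ, true_and] at hu hv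
  by_contra hvd
  rw [mem_coe, mem_filter_univ] at hvd
  exact huvH (hH.2 (hH.1.insert huB hvB hv.1 hadj hu.2 hvd) (subset_insert _ _)
    (mem_insert_self _ _))

variable {ε s : ℝ}

lemma maxDegree_mul_card_saturated_le (hD : 0 < D) (hdD : 4 * (d : ℝ) * G.maxDegree ≤ s * D)
    (hH : (#H : ℝ) ≤ d * #B) :
    (#{u | #{e ∈ H | e.1 = u} = D} : ℝ) * G.maxDegree ≤ s * #B / 4 := by
  have hsat : (D * #{u | #{e ∈ H | e.1 = u} = D} : ℝ) ≤ d * #B :=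
    le_trans (by exact_mod_cast mul_card_filter_card_fiber_eq_le Prod.fst H D) hH
  have hD' : (0 : ℝ) < D := by exact_mod_cast hD
  refine le_of_mul_le_mul_left ?_ hD'
  calc D * ((#{u | #{e ∈ H | e.1 = u} = D} : ℝ) * G.maxDegree)
      = D * #{u | #{e ∈ H | e.1 = u} = D} * G.maxDegree := by ring
    _ ≤ d * #B * G.maxDegree := by gcongr
    _ = 4 * d * G.maxDegree * #B / 4 := by ring
    _ ≤ s * D * #B / 4 := by gcongr
    _ = D * (s * #B / 4) := by ring

lemma IsExpander.le_card_of_maximal (hG : IsExpander G ε s)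
    (hεn : ε / Real.logb 2 (Fintype.card V) ^ 2 ≤ 1) (hB1 : 1 ≤ #B)
    (hB : (#B : ℝ) ≤ 2 / 3 * Fintype.card V) (hW : (G.maxDegree : ℝ) * #W ≤ s * #B / 4)
    (hd : 4 * (d : ℝ) ≤ s) (hD : 0 < D) (hdD : 4 * (d : ℝ) * G.maxDegree ≤ s * D)
    (hH : Maximal (IsSparseCut G B W D d) H) :
    d * (ε * #B / Real.logb 2 (Fintype.card V) ^ 2) ≤ (#H : ℝ) := by
  set full : Finset V := {u | #{e ∈ H | e.1 = u} = D}
  -- A small `H` may be deleted together with all edges at `W` and at the saturated vertices of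
  -- `B`; what still expands out of `B` is then saturated on the other side.
  by_contra! hlt
  have hHle : (#H : ℝ) ≤ d * #B := by
    refine hlt.le.trans (mul_le_mul_of_nonneg_left ?_ d.cast_nonneg)
    rw [mul_div_right_comm]
    exact mul_le_of_le_one_left (Nat.cast_nonneg _) hεn
  have hfull : (#full : ℝ) * G.maxDegree ≤ s * #B / 4 :=
    maxDegree_mul_card_saturated_le hD hdD hHle
  have hcard : (#(edgesAt G (W ∪ full) H) : ℝ) ≤ s * #B := by
    have hle : (#(edgesAt G (W ∪ full) H) : ℝ) ≤ #H + (#W + #full) * G.maxDegree := by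
      exact_mod_cast (card_edgesAt_le _ _).trans
        (Nat.add_le_add_left (Nat.mul_le_mul_right _ (card_union_le _ _)) _)
    have := mul_le_mul_of_nonneg_right hd (#B).cast_nonneg
    have : 0 ≤ (d : ℝ) * #B := by positivity
    linarith
  have hexp := hG B _ (coe_edgesAt_subset _ hH.1.adj) hB1 hB hcard
  have hsat := Set.ncard_le_ncard (extNeighbors_deleteEdges_edgesAt_subset hH) (finite_toSet _)
  rw [Set.ncard_coe_finset] at hsat
  refine hlt.not_ge ((mul_le_mul_of_nonneg_left
    (hexp.trans (Nat.cast_le.2 hsat)) d.cast_nonneg).trans ?_)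
  exact_mod_cast mul_card_filter_card_fiber_eq_le Prod.snd H d

lemma IsExpander.exists_isSparseCut (hG : IsExpander G ε s)
    (hεn : ε / Real.logb 2 (Fintype.card V) ^ 2 ≤ 1) (hB1 : 1 ≤ #B)
    (hB : (#B : ℝ) ≤ 2 / 3 * Fintype.card V) (hW : (G.maxDegree : ℝ) * #W ≤ s * #B / 4)
    (hd : 4 * (d : ℝ) ≤ s) (hD : 0 < D) (hdD : 4 * (d : ℝ) * G.maxDegree ≤ s * D) :
    ∃ H, IsSparseCut G B W D d H ∧
      d * (ε * #B / Real.logb 2 (Fintype.card V) ^ 2) ≤ (#H : ℝ) := by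
  obtain ⟨H, hH⟩ := (Set.toFinite {H | IsSparseCut G B W D d H}).exists_maximal
    ⟨∅, by constructor <;> simp⟩
  exact ⟨H, hH.1, hG.le_card_of_maximal hεn hB1 hB hW hd hD hdD hH⟩

end SparseCut

section Degree

variable {V : Type*} [Fintype V] {G : SimpleGraph V} [DecidableRel G.Adj] {ε s : ℝ}

lemma IsExpander.lt_degree (hG : IsExpander G ε s) (hε : 0 < ε) (hn : 2 ≤ Fintype.card V)
    (v : V) : s < G.degree v := by
  classical
  by_contra! h
  have hn' : (2 : ℝ) ≤ Fintype.card V := by exact_mod_cast hn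
  have hisolated : extNeighbors
      (G.deleteEdges (edgesAt G {v} (∅ : Finset (V × V)) : Set (Sym2 V))) {v} = ∅ := by
    refine Set.eq_empty_iff_forall_notMem.2 fun w hw ↦ ?_
    obtain ⟨-, u, hu, huw⟩ := hw
    exact (adj_of_deleteEdges_edgesAt_adj huw).2.2.1 hu
  have hexp := hG {v} _ (coe_edgesAt_subset {v} (H := ∅) (by simp)) (by simp)
    (by simp only [card_singleton, Nat.cast_one]; linarith)
    (by simpa [edgesAt] using h)
  rw [hisolated, Set.ncard_empty, card_singleton, Nat.cast_one, mul_one, Nat.cast_zero] at hexp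
  have : 0 < Real.logb 2 (Fintype.card V) := Real.logb_pos (by norm_num) (by linarith)
  exact hexp.not_gt (by positivity)

lemma IsExpander.le_maxDegree (hG : IsExpander G ε s) (hε : 0 < ε) (hn : 2 ≤ Fintype.card V) :
    s ≤ G.maxDegree := by
  obtain ⟨v⟩ : Nonempty V := Fintype.card_pos_iff.1 (by omega)
  exact (hG.lt_degree hε hn v).le.trans (by exact_mod_cast G.degree_le_maxDegree v)

end Degree

/-! ### Growing a set through a random set -/

section NeighborTail

variable {α β : Type*} [Fintype α] [Fintype β] [DecidableEq α] [DecidableEq β]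

lemma mul_div_two_le_one_sub_pow {x : ℝ} (hx : 0 ≤ x) {k : ℕ} (hk : k * x ≤ 1) :
    k * x / 2 ≤ 1 - (1 - x) ^ k := by
  obtain rfl | hk0 := Nat.eq_zero_or_pos k
  · simp
  have hx1 : x ≤ 1 := (le_mul_of_one_le_left hx (by exact_mod_cast hk0)).trans hk
  have hpow : (1 - x) ^ k ≤ Real.exp (-(k * x)) := by
    rw [← mul_neg, Real.exp_nat_mul]
    exact pow_le_pow_left₀ (sub_nonneg.2 hx1) (Real.one_sub_le_exp_neg x) k
  linarith [exp_neg_le_one_sub_half (by positivity) hk]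

lemma bernoulliProb_card_neighbors_lt_le {q : ℝ} (hq : q ∈ Set.Icc (0 : ℝ) 1)
    {H : Finset (α × β)} {D : ℕ} (hD : 0 < D) (hfst : ∀ u, #{e ∈ H | e.1 = u} ≤ D)
    (hsnd : ∀ v, q * (#{e ∈ H | e.2 = v} : ℝ) ≤ 2) :
    bernoulliProb q
        (fun S ↦ (#{v | ¬ Disjoint ({u | (u, v) ∈ H} : Finset α) S} : ℝ) < q * #H / 8) ≤
      Real.exp (-(q * #H / (8 * D))) := by
  have : (0 : ℝ) < D := by exact_mod_cast hD
  have card_left v : #({u | (u, v) ∈ H} : Finset α) = #{e ∈ H | e.2 = v} :=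
    card_bij (fun u _ ↦ (u, v)) (by simp) (by simp) fun e he ↦ by
      rw [mem_filter] at he
      exact ⟨e.1, by simp [← he.2, he.1], by simp [← he.2]⟩
  have card_right u : #({v | (u, v) ∈ H} : Finset β) ≤ D :=
    (card_le_card_of_injOn (fun v ↦ (u, v)) (fun v hv ↦ by simpa using hv)
      fun v _ w _ h ↦ by simpa using h).trans (hfst u)
  have hsum : q * #H / 4 ≤ ∑ v, (1 - (1 - q / 2) ^ #({u | (u, v) ∈ H} : Finset α)) := by
    have hfiber : (#H : ℝ) = ∑ v, (#{e ∈ H | e.2 = v} : ℝ) := by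
      exact_mod_cast card_eq_sum_card_fiberwise (f := Prod.snd) fun _ _ ↦ mem_coe.2 (mem_univ _)
    rw [hfiber, mul_sum, sum_div]
    refine sum_le_sum fun v _ ↦ ?_
    rw [card_left]
    linarith [mul_div_two_le_one_sub_pow (x := q / 2) (by linarith [hq.1])
      (k := #{e ∈ H | e.2 = v}) (by linarith [hsnd v])]
  have key := bernoulliProb_card_filter_not_disjoint_lt_le hq univ
    (fun v ↦ ({u | (u, v) ∈ H} : Finset α)) hD (fun u ↦ by simpa using card_right u)
    (q * #H / (8 * D))
  rw [show (D : ℝ) * (q * #H / (8 * D)) = q * #H / 8 by field_simp] at key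
  refine key.trans (Real.exp_le_exp.2 ?_)
  calc q * #H / (8 * D) - (∑ v, (1 - (1 - q / 2) ^ #({u | (u, v) ∈ H} : Finset α))) / D
      ≤ q * #H / (8 * D) - q * #H / 4 / D := by gcongr
    _ = -(q * #H / (8 * D)) := by field_simp; ring

end NeighborTail

lemma exists_half_biUnion {α ι : Type*} [DecidableEq α] {X : Finset ι} {B : ι → Finset α}
    {b : ℝ} {j : ℕ}
    (hX : #X ≤ 2 ^ (j + 1)) (hB : 2 * b ≤ #(X.biUnion B)) :
    ∃ Y ⊆ X, #Y ≤ 2 ^ j ∧ b ≤ #(Y.biUnion B) := by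
  classical
  rw [pow_succ] at hX
  obtain ⟨Y, hYX, hY⟩ := exists_subset_card_eq (s := X) (n := #X / 2) (by omega)
  have hY' : #(X \ Y) = #X - #X / 2 := by rw [card_sdiff_of_subset hYX, hY]
  have hcover : (#(X.biUnion B) : ℝ) ≤ #(Y.biUnion B) + #((X \ Y).biUnion B) := by
    rw [← union_sdiff_of_subset hYX, union_biUnion, union_sdiff_of_subset hYX]
    exact_mod_cast card_union_le _ _
  obtain h | h := le_or_gt b #(Y.biUnion B)
  · exact ⟨Y, hYX, by omega, h⟩
  · exact ⟨X \ Y, sdiff_subset, by omega, by linarith⟩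

section Growth

variable {V : Type*} [Fintype V] [DecidableEq V] {G : SimpleGraph V} [DecidableRel G.Adj]
  {S S' T W B B' : Finset V}

variable (G) in
/-- `B` together with the vertices outside `W` that are adjacent to a vertex of `B ∩ S`: one step
of exploration from `B` through `S`, avoiding `W`. -/
def grow (S W B : Finset V) : Finset V :=
  B ∪ ({v | v ∉ W ∧ ∃ u ∈ B, u ∈ S ∧ G.Adj u v} : Finset V)

lemma mem_grow {v : V} :
    v ∈ grow G S W B ↔ v ∈ B ∨ v ∉ W ∧ ∃ u ∈ B, u ∈ S ∧ G.Adj u v := by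
  simp [grow]

lemma subset_grow (S W B : Finset V) : B ⊆ grow G S W B := subset_union_left

lemma grow_mono (hS : S ⊆ S') (hB : B ⊆ B') : grow G S W B ⊆ grow G S' W B' := by
  intro v
  simp only [mem_grow]
  rintro (h | ⟨h, u, hu, huS, huv⟩)
  · exact .inl (hB h)
  · exact .inr ⟨h, u, hB hu, hS huS, huv⟩

lemma grow_biUnion_subset {ι : Type*} (S W : Finset V) (X : Finset ι) (B : ι → Finset V) :
    grow G S W (X.biUnion B) ⊆ X.biUnion (fun x ↦ grow G S W (B x)) := by
  intro v hv
  simp only [mem_grow, mem_biUnion] at hv ⊢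
  rcases hv with ⟨x, hx, hv⟩ | ⟨hW, u, ⟨x, hx, hu⟩, huS, huv⟩
  · exact ⟨x, hx, .inl hv⟩
  · exact ⟨x, hx, .inr ⟨hW, u, hu, huS, huv⟩⟩

lemma subset_iterate_grow (S W B : Finset V) (k : ℕ) : B ⊆ (grow G S W)^[k] B := by
  induction k with
  | zero => exact subset_rfl
  | succ k ih => rw [Function.iterate_succ_apply']; exact ih.trans (subset_grow _ _ _)

lemma iterate_grow_mono (hS : S ⊆ S') (hB : B ⊆ B') (k : ℕ) :
    (grow G S W)^[k] B ⊆ (grow G S' W)^[k] B' := by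
  induction k with
  | zero => exact hB
  | succ k ih => simpa only [Function.iterate_succ_apply'] using grow_mono hS ih

lemma iterate_grow_biUnion_subset {ι : Type*} (S W : Finset V) (X : Finset ι)
    (B : ι → Finset V) (k : ℕ) :
    (grow G S W)^[k] (X.biUnion B) ⊆ X.biUnion (fun x ↦ (grow G S W)^[k] (B x)) := by
  induction k with
  | zero => exact subset_rfl
  | succ k ih =>
    simp only [Function.iterate_succ_apply']
    exact (grow_mono subset_rfl ih).trans (grow_biUnion_subset _ _ _ _)

lemma iterate_grow_iterate_grow_subset (S T W B : Finset V) (k m : ℕ) :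
    (grow G T W)^[m] ((grow G S W)^[k] B) ⊆ (grow G (S ∪ T) W)^[k + m] B := by
  rw [Nat.add_comm, Function.iterate_add_apply]
  exact iterate_grow_mono subset_union_right (iterate_grow_mono subset_union_left subset_rfl k) m

lemma IsSparseCut.card_add_card_le_card_grow {D d : ℕ} {H : Finset (V × V)}
    (hH : IsSparseCut G B W D d H) (S : Finset V) :
    #B + #{v | ¬ Disjoint ({u | (u, v) ∈ H} : Finset V) S} ≤ #(grow G S W B) := by
  have exists_edge v (hv : v ∈ ({v | ¬ Disjoint ({u | (u, v) ∈ H} : Finset V) S} : Finset V)) :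
      ∃ u ∈ S, (u, v) ∈ H := by
    obtain ⟨u, huv, hu⟩ := not_disjoint_iff.1 (mem_filter.1 hv).2
    exact ⟨u, hu, (mem_filter.1 huv).2⟩
  rw [← card_union_of_disjoint]
  · refine card_le_card (union_subset (subset_grow _ _ _) fun v hv ↦ ?_)
    obtain ⟨u, hu, huv⟩ := exists_edge v hv
    exact mem_grow.2 (.inr ⟨hH.snd_notMem_deleted _ huv, u, hH.fst_mem _ huv, hu, hH.adj _ huv⟩)
  · refine disjoint_right.2 fun v hv ↦ ?_
    obtain ⟨u, -, huv⟩ := exists_edge v hv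
    exact hH.snd_notMem _ huv

variable {q : ℝ}

lemma exists_sparse_degrees {s Δ : ℝ} (hq0 : 0 < q) (hq1 : q ≤ 1) (hqs : 8 ≤ q * s)
    (hsΔ : s ≤ Δ) :
    ∃ d D : ℕ, 1 ≤ q * d ∧ q * d ≤ 2 ∧ 4 * (d : ℝ) ≤ s ∧ 0 < D ∧ 4 * (d : ℝ) * Δ ≤ s * D ∧
      q * s * D ≤ 16 * Δ := by
  have hs : 0 < s := pos_of_mul_pos_right (by linarith) hq0.le
  have hqd : 1 ≤ q * (⌈1 / q⌉₊ : ℝ) := (div_le_iff₀' hq0).1 (Nat.le_ceil _)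
  have hqd2 : q * (⌈1 / q⌉₊ : ℝ) ≤ 2 := by
    have := mul_lt_mul_of_pos_left (Nat.ceil_lt_add_one (one_div_pos.2 hq0).le) hq0
    rw [mul_add, mul_one_div_cancel hq0.ne'] at this
    linarith
  generalize ⌈1 / q⌉₊ = d at hqd hqd2
  have hd : (0 : ℝ) < d := pos_of_mul_pos_right (by linarith) hq0.le
  have hratio : 0 < 4 * d * Δ / s := by have := hs.trans_le hsΔ; positivity
  refine ⟨d, ⌈4 * d * Δ / s⌉₊, hqd, hqd2, le_of_mul_le_mul_left (by linarith) hq0,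
    Nat.ceil_pos.2 hratio, (div_le_iff₀' hs).1 (Nat.le_ceil _), ?_⟩
  calc q * s * (⌈4 * d * Δ / s⌉₊ : ℝ) ≤ q * s * (4 * d * Δ / s + 1) := by
        gcongr
        exact (Nat.ceil_lt_add_one hratio.le).le
    _ = q * d * (4 * Δ) + q * s := by field_simp
    _ ≤ 2 * (4 * Δ) + 1 * s := by gcongr; linarith
    _ ≤ 16 * Δ := by linarith

lemma IsExpander.bernoulliProb_card_grow_lt_le {ε s b : ℝ} (hG : IsExpander G ε s) (hε : 0 < ε)
    (hn : 2 ≤ Fintype.card V) (hεn : ε / Real.logb 2 (Fintype.card V) ^ 2 ≤ 1)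
    (hq0 : 0 < q) (hq1 : q ≤ 1) (hqs : 8 ≤ q * s) (hb : 0 < b) (hbB : b ≤ #B)
    (hB : (#B : ℝ) ≤ 2 / 3 * Fintype.card V) (hW : (G.maxDegree : ℝ) * #W ≤ s * b / 4) :
    bernoulliProb q (fun S ↦ (#(grow G S W B) : ℝ) <
        (1 + ε / (8 * Real.logb 2 (Fintype.card V) ^ 2)) * #B) ≤
      Real.exp (-(ε * q * s / (128 * G.maxDegree * Real.logb 2 (Fintype.card V) ^ 2) * b)) := by
  set l := Real.logb 2 (Fintype.card V) with hl
  have hl0 : 0 < l := Real.logb_pos (by norm_num) (by exact_mod_cast hn)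
  have hs : 0 < s := pos_of_mul_pos_right (by linarith) hq0.le
  have hΔ : (0 : ℝ) < G.maxDegree := hs.trans_le (hG.le_maxDegree hε hn)
  obtain ⟨d, D, hqd, hqd2, hds, hD, hdD, hqsD⟩ :=
    exists_sparse_degrees hq0 hq1 hqs (hG.le_maxDegree hε hn)
  have hD' : (0 : ℝ) < D := by exact_mod_cast hD
  obtain ⟨H, hH, hcard⟩ := hG.exists_isSparseCut hεn (by exact_mod_cast hb.trans_le hbB) hB
    (hW.trans (by gcongr)) hds hD hdD
  have hqH : ε * #B / l ^ 2 ≤ q * #H :=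
    calc ε * #B / l ^ 2 ≤ q * d * (ε * #B / l ^ 2) := le_mul_of_one_le_left (by positivity) hqd
      _ = q * (d * (ε * #B / l ^ 2)) := by ring
      _ ≤ q * #H := by gcongr
  refine (bernoulliProb_mono ⟨hq0.le, hq1⟩ fun S hS ↦ ?_).trans
    ((bernoulliProb_card_neighbors_lt_le ⟨hq0.le, hq1⟩ hD hH.card_fst_le fun v ↦ ?_).trans
      (Real.exp_le_exp.2 (neg_le_neg ?_)))
  · have hgrow : (#B + #{v | ¬ Disjoint ({u | (u, v) ∈ H} : Finset V) S} : ℝ) ≤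
        #(grow G S W B) := by exact_mod_cast hH.card_add_card_le_card_grow S
    have hsplit : (1 + ε / (8 * l ^ 2)) * #B = #B + ε * #B / l ^ 2 / 8 := by field_simp
    linarith
  · refine le_trans ?_ hqd2
    gcongr
    exact hH.card_snd_le v
  · calc ε * q * s / (128 * G.maxDegree * l ^ 2) * b
        = ε * b / l ^ 2 * (q * s) / (8 * (16 * G.maxDegree)) := by field_simp; ring
      _ ≤ ε * #B / l ^ 2 * (q * s) / (8 * (q * s * D)) := by gcongr
      _ = ε * #B / l ^ 2 / (8 * D) := by field_simp
      _ ≤ q * #H / (8 * D) := by gcongr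

variable {γ η b t : ℝ}

lemma bernoulliProb_card_iterate_grow_lt_le (hq : q ∈ Set.Icc (0 : ℝ) 1) (hγ : 0 ≤ γ) (hη : 0 ≤ η)
    (hstep : ∀ B : Finset V, b ≤ #B → (#B : ℝ) ≤ t →
      bernoulliProb q (fun S ↦ (#(grow G S W B) : ℝ) < (1 + γ) * #B) ≤ η)
    (L : ℕ) (hB : b ≤ #B) :
    bernoulliProb (1 - (1 - q) ^ L)
        (fun S ↦ (#((grow G S W)^[L] B) : ℝ) < min t ((1 + γ) ^ L * #B)) ≤ L * η := by
  induction L generalizing B with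
  | zero => rw [bernoulliProb_eq_zero] <;> simp
  | succ L ih =>
    obtain ht | ht := lt_or_ge t #B
    · rw [bernoulliProb_eq_zero _ fun S hS ↦ ?_]
      · positivity
      · refine (hS.trans_le (min_le_left _ _)).not_ge (ht.le.trans ?_)
        exact_mod_cast card_le_card (subset_iterate_grow S W B (L + 1))
    have hfirst : bernoulliProb (1 - (1 - q) ^ 1)
        (fun S ↦ (#(grow G S W B) : ℝ) < (1 + γ) * #B) ≤ η := by simpa using hstep B hB ht
    rw [Nat.add_comm L 1]
    refine (bernoulliProb_union_pow_le hq 1 L (c := L * η) (by positivity)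
      (P := fun S ↦ (#(grow G S W B) : ℝ) < (1 + γ) * #B)
      (Q := fun S T ↦ (#((grow G T W)^[L] (grow G S W B)) : ℝ) <
        min t ((1 + γ) ^ L * #(grow G S W B))) (fun S T hST ↦ ?_) fun S _ ↦ ?_).trans ?_
    · by_contra! h
      refine hST.not_ge (le_trans ?_ (h.2.trans ?_))
      · rw [add_comm 1 L, pow_succ, mul_assoc]
        gcongr
        exact h.1
      · exact_mod_cast card_le_card (iterate_grow_iterate_grow_subset S T W B 1 L)
    · exact ih (hB.trans (by exact_mod_cast card_le_card (subset_grow _ _ _)))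
    · push_cast
      linarith

lemma bernoulliProb_forall_card_iterate_grow_lt_le {ι : Type*} (hq : q ∈ Set.Icc (0 : ℝ) 1)
    (hη : 0 ≤ η) (hb : 0 < b) (hbt : 2 * b ≤ t) {L : ℕ}
    (hphase : ∀ B : Finset V, b ≤ #B →
      bernoulliProb (1 - (1 - q) ^ L) (fun S ↦ (#((grow G S W)^[L] B) : ℝ) < t) ≤ η)
    (j : ℕ) {X : Finset ι} {B : ι → Finset V} (hX : #X ≤ 2 ^ j) (hB : b ≤ #(X.biUnion B)) :
    bernoulliProb (1 - (1 - q) ^ (L * (j + 1)))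
      (fun S ↦ ∀ x ∈ X, (#((grow G S W)^[L * (j + 1)] (B x)) : ℝ) < t) ≤ (j + 1) * η := by
  induction j generalizing X B with
  | zero =>
    have hne : X.Nonempty := by
      rw [nonempty_iff_ne_empty]
      rintro rfl
      simp only [biUnion_empty, card_empty, Nat.cast_zero] at hB
      linarith
    obtain ⟨x, rfl⟩ := card_eq_one.1 (le_antisymm (by simpa using hX) hne.card_pos)
    rw [singleton_biUnion] at hB
    simpa using hphase (B x) hB
  | succ j ih =>
    rw [show L * (j + 1 + 1) = L + L * (j + 1) by ring]
    refine (bernoulliProb_union_pow_le hq L (L * (j + 1)) (c := (j + 1) * η) (by positivity)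
      (P := fun S ↦ (#((grow G S W)^[L] (X.biUnion B)) : ℝ) < t)
      (Q := fun S T ↦ ∀ x ∈ X,
        (#((grow G T W)^[L * (j + 1)] ((grow G S W)^[L] (B x))) : ℝ) < t)
      (fun S T hST ↦ .inr fun x hx ↦ lt_of_le_of_lt ?_ (hST x hx)) fun S hS ↦ ?_).trans ?_
    · exact_mod_cast card_le_card (iterate_grow_iterate_grow_subset S T W (B x) L (L * (j + 1)))
    · have hlarge : 2 * b ≤ #(X.biUnion fun x ↦ (grow G S W)^[L] (B x)) :=
        hbt.trans ((not_lt.1 hS).trans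
          (by exact_mod_cast card_le_card (iterate_grow_biUnion_subset S W X B L)))
      obtain ⟨Y, hYX, hY, hYb⟩ := exists_half_biUnion hX hlarge
      exact (bernoulliProb_mono (one_sub_one_sub_pow_mem_Icc hq _)
        fun T hT x hx ↦ hT x (hYX hx)).trans (ih hY hYb)
    · push_cast
      linarith [hphase _ hB]

end Growth

/-! ### Disjoint paths between the terminals -/

section Paths

variable {V : Type*} {G : SimpleGraph V}

lemma internalVertices_finite {x y : V} (P : G.Walk x y) : (internalVertices P).Finite :=
  P.support.finite_toSet.subset fun _ hv ↦ hv.1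

lemma ncard_internalVertices_le_length {x y : V} (P : G.Walk x y) :
    (internalVertices P).ncard ≤ P.length := by
  classical
  have hsub : internalVertices P ⊆ (P.support.tail.toFinset : Set V) := by
    rintro v ⟨hv, hvx, -⟩
    rw [← P.cons_tail_support, List.mem_cons] at hv
    exact mem_coe.2 (List.mem_toFinset.2 (hv.resolve_left hvx))
  calc (internalVertices P).ncard ≤ #P.support.tail.toFinset := by
        simpa only [Set.ncard_coe_finset] using Set.ncard_le_ncard hsub (finite_toSet _)
    _ ≤ P.support.tail.length := P.support.tail.toFinset_card_le
    _ = P.length := by simp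

lemma exists_isPath_pairwise_disjoint_internalVertices {ι : Type*} [Finite ι] {x y : ι → V}
    {S : Set V} {ℓ : ℝ} (hℓ : 0 ≤ ℓ)
    (h : ∀ I : Finset ι, I.Nonempty → ∀ W : Finset V, (#W : ℝ) ≤ 2 * ℓ * #I →
      ∃ i ∈ I, ∃ P : G.Walk (x i) (y i), P.IsPath ∧ internalVertices P ⊆ S \ W ∧ P.length ≤ ℓ) :
    ∃ P : ∀ i, G.Walk (x i) (y i),
      (∀ i, (P i).IsPath ∧ internalVertices (P i) ⊆ S ∧ (P i).length ≤ ℓ) ∧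
        ∀ i j, i ≠ j → Disjoint (internalVertices (P i)) (internalVertices (P j)) := by
  classical
  let E (i : ι) : Set (Finset V) := {e | ∃ P : G.Walk (x i) (y i),
    (P.IsPath ∧ internalVertices P ⊆ S ∧ P.length ≤ ℓ) ∧ (e : Set V) = internalVertices P}
  have hcard i e (he : e ∈ E i) : #e ≤ ⌊ℓ⌋₊ := by
    obtain ⟨P, ⟨-, -, hlen⟩, hint⟩ := he
    rw [← Set.ncard_coe_finset, hint]
    exact (ncard_internalVertices_le_length P).trans (Nat.le_floor hlen)
  obtain ⟨M, hM, hdisj⟩ := exists_pairwise_disjoint_representatives hcard fun I hI W hW ↦ by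
    have hW' : (#W : ℝ) ≤ 2 * ℓ * #I :=
      calc (#W : ℝ) ≤ 2 * ⌊ℓ⌋₊ * #I := by exact_mod_cast hW
        _ ≤ 2 * ℓ * #I := by gcongr; exact Nat.floor_le hℓ
    obtain ⟨i, hi, P, hP, hint, hlen⟩ := h I hI W hW'
    refine ⟨i, hi, (internalVertices_finite P).toFinset,
      ⟨P, ⟨hP, hint.trans Set.sdiff_subset, hlen⟩, by simp⟩, disjoint_left.2 fun v hv ↦ ?_⟩
    exact (hint ((Set.Finite.mem_toFinset _).1 hv)).2
  choose P hP hint using hM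
  exact ⟨P, hP, fun i j hij ↦ by simpa only [← hint, disjoint_coe] using hdisj i j hij⟩

end Paths

section Reach

variable {V : Type*} [Fintype V] [DecidableEq V] {G : SimpleGraph V} [DecidableRel G.Adj]
  {S T W B : Finset V}

lemma exists_walk_of_mem_iterate_grow (hBW : Disjoint B W) {k : ℕ} {v : V}
    (hv : v ∈ (grow G S W)^[k] B) :
    ∃ u ∈ B, ∃ P : G.Walk u v, P.length ≤ k ∧ ∀ z ∈ P.support, z ∉ W ∧ (z ≠ v → z ∈ S) := by
  induction k generalizing v with
  | zero =>
    refine ⟨v, hv, .nil, le_rfl, fun z hz ↦ ?_⟩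
    obtain rfl : z = v := by simpa using hz
    exact ⟨disjoint_left.1 hBW hv, fun h ↦ (h rfl).elim⟩
  | succ k ih =>
    rw [Function.iterate_succ_apply'] at hv
    obtain hv | ⟨hvW, w, hw, hwS, hwv⟩ := mem_grow.1 hv
    · obtain ⟨u, hu, P, hPk, hP⟩ := ih hv
      exact ⟨u, hu, P, hPk.trans k.le_succ, hP⟩
    · obtain ⟨u, hu, P, hPk, hP⟩ := ih hw
      refine ⟨u, hu, P.concat hwv, by simpa using hPk, fun z hz ↦ ?_⟩
      rw [Walk.support_concat, List.mem_append, List.mem_singleton] at hz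
      obtain hz | rfl := hz
      · refine ⟨(hP z hz).1, fun _ ↦ ?_⟩
        obtain rfl | hzw := eq_or_ne z w
        · exact hwS
        · exact (hP z hz).2 hzw
      · exact ⟨hvW, fun h ↦ (h rfl).elim⟩

variable (G) in
/-- The vertices reached from the neighbourhood of `x` in at most `N` steps through `S`, with `W`
avoided throughout. -/
def reach (S W : Finset V) (N : ℕ) (x : V) : Finset V :=
  (grow G S W)^[N] (G.neighborFinset x \ W)

variable (G) in
/-- The vertices outside `W` that have a neighbour in `X`; unlike in `extNeighbors`, they may lie
in `X`. -/
def outerNeighbors (X W : Finset V) : Finset V :=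
  X.biUnion fun x ↦ G.neighborFinset x \ W

lemma exists_isPath_of_mem_reach {N : ℕ} {x y z : V} (hz : z ∈ T) (hx : z ∈ reach G S W N x)
    (hy : z ∈ reach G S W N y) :
    ∃ P : G.Walk x y, P.IsPath ∧ P.length ≤ 2 * N + 2 ∧
      internalVertices P ⊆ ((S ∪ T : Finset V) : Set V) \ W := by
  obtain ⟨u, hu, P, hPN, hP⟩ := exists_walk_of_mem_iterate_grow sdiff_disjoint hx
  obtain ⟨u', hu', P', hPN', hP'⟩ := exists_walk_of_mem_iterate_grow sdiff_disjoint hy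
  have hxu : G.Adj x u := by simpa using (mem_sdiff.1 hu).1
  have hyu : G.Adj u' y := by simpa [G.adj_comm] using (mem_sdiff.1 hu').1
  let R : G.Walk x y := (Walk.cons hxu (P.append P'.reverse)).concat hyu
  have mem_support v (hv : v ∈ internalVertices R.bypass) : v ∈ P.support ∨ v ∈ P'.support := by
    obtain ⟨hvR, hvx, hvy⟩ := hv
    have := R.support_bypass_subset_support hvR
    simpa only [R, Walk.support_concat, Walk.support_cons, List.mem_append, List.mem_cons, hvx,
      Walk.mem_support_append_iff, Walk.support_reverse, List.mem_reverse, List.not_mem_nil, hvy,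
      false_or, or_false] using this
  have mem_of_avoids v (hv : v ∉ W ∧ (v ≠ z → v ∈ S)) : v ∈ ((S ∪ T : Finset V) : Set V) \ W := by
    obtain rfl | hvz := eq_or_ne v z
    · exact ⟨mem_coe.2 (mem_union_right _ hz), hv.1⟩
    · exact ⟨mem_coe.2 (mem_union_left _ (hv.2 hvz)), hv.1⟩
  refine ⟨R.bypass, R.bypass_isPath, R.length_bypass_le_length.trans ?_, fun v hv ↦ ?_⟩
  · simp only [R, Walk.length_concat, Walk.length_cons, Walk.length_append, Walk.length_reverse]
    lia
  · exact mem_of_avoids v ((mem_support v hv).elim (hP v) (hP' v))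

variable {D Q ℓ θ : ℝ} {ι : Type*} [Finite ι] {f : ι → V}

lemma card_mul_le_two_mul_card_outerNeighbors (hD : 0 < D)
    (hdeg : ∀ v, D * Q ≤ #(G.neighborFinset v ∩ S))
    (hf : ∀ v ∈ S, ({i | G.Adj v (f i)}.ncard : ℝ) ≤ D) (K : Finset ι)
    (hW : (#W : ℝ) ≤ Q / 2 * #K) :
    #K * Q ≤ 2 * #(outerNeighbors G (K.image f) W) := by
  set N := (K.image f).biUnion fun x ↦ G.neighborFinset x ∩ S
  have hcount : #K • (D * Q) ≤ #N • D := by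
    refine card_nsmul_le_card_nsmul (fun i v ↦ G.Adj v (f i)) (fun i hi ↦ ?_) fun v hv ↦ ?_
    · refine (hdeg (f i)).trans (Nat.cast_le.2 (card_le_card fun v hv ↦ ?_))
      exact (mem_bipartiteAbove _).2 ⟨mem_biUnion.2 ⟨f i, mem_image_of_mem f hi, hv⟩,
        by simpa [G.adj_comm] using (mem_inter.1 hv).1⟩
    · obtain ⟨x, -, hx⟩ := mem_biUnion.1 hv
      refine le_trans ?_ (hf v (mem_inter.1 hx).2)
      rw [← Set.ncard_coe_finset]
      exact_mod_cast Set.ncard_le_ncard (fun i hi ↦ ((mem_bipartiteBelow _).1 hi).2)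
        (Set.toFinite _)
  have hKN : #K * Q ≤ #N := by
    rw [nsmul_eq_mul, nsmul_eq_mul] at hcount
    exact le_of_mul_le_mul_right (by linarith) hD
  have hNW : N ⊆ outerNeighbors G (K.image f) W ∪ W := by
    refine biUnion_subset.2 fun x hx v hv ↦ ?_
    by_cases hvW : v ∈ W
    · exact mem_union_right _ hvW
    · exact mem_union_left _ (mem_biUnion.2 ⟨x, hx, mem_sdiff.2 ⟨(mem_inter.1 hv).1, hvW⟩⟩)
  have : (#N : ℝ) ≤ #(outerNeighbors G (K.image f) W) + #W := by
    exact_mod_cast (card_le_card hNW).trans (card_union_le _ _)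
  linarith

variable (G) in
/-- `X` has at least `Q / 2` outer neighbours per vertex, and `W` is negligible compared with these
outer neighbours. Every such `X` contains a vertex of large reach (with high probability), and
large families of terminals are such sets. -/
structure IsSpread (Q ℓ : ℝ) (X W : Finset V) : Prop where
  nonempty : X.Nonempty
  card_mul_le : #X * Q ≤ 2 * #(outerNeighbors G X W)
  card_avoided_mul_le : #W * Q ≤ 8 * ℓ * #(outerNeighbors G X W)

lemma isSpread_image (hD : 0 < D) (hℓ : 0 ≤ ℓ) (hQ : 8 * ℓ ≤ Q)
    (hdeg : ∀ v, D * Q ≤ #(G.neighborFinset v ∩ S))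
    (hf : ∀ v ∈ S, ({i | G.Adj v (f i)}.ncard : ℝ) ≤ D) {K : Finset ι} (hK : K.Nonempty)
    (hW : (#W : ℝ) ≤ 4 * ℓ * #K) : IsSpread G Q ℓ (K.image f) W := by
  have hQ0 : 0 ≤ Q := by linarith
  have hcard : #K * Q ≤ 2 * #(outerNeighbors G (K.image f) W) :=
    card_mul_le_two_mul_card_outerNeighbors hD hdeg hf K (hW.trans (by gcongr; linarith))
  refine ⟨hK.image f, le_trans (by gcongr; exact card_image_le) hcard, ?_⟩
  calc #W * Q ≤ 4 * ℓ * #K * Q := by gcongr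
    _ = 4 * ℓ * (#K * Q) := by ring
    _ ≤ 4 * ℓ * (2 * #(outerNeighbors G (K.image f) W)) := by gcongr
    _ = 8 * ℓ * #(outerNeighbors G (K.image f) W) := by ring

variable {N : ℕ}

lemma two_mul_card_filter_reach_lt (hD : 0 < D) (hℓ : 0 ≤ ℓ) (hQ : 8 * ℓ ≤ Q)
    (hdeg : ∀ v, D * Q ≤ #(G.neighborFinset v ∩ S))
    (hgrow : ∀ X, IsSpread G Q ℓ X W → ∃ x ∈ X, θ ≤ #(reach G S W N x))
    (hf : ∀ v ∈ S, ({i | G.Adj v (f i)}.ncard : ℝ) ≤ D) {I : Finset ι} (hI : I.Nonempty)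
    (hW : (#W : ℝ) ≤ 2 * ℓ * #I) : 2 * #{i ∈ I | (#(reach G S W N (f i)) : ℝ) < θ} < #I := by
  by_contra! hcard
  set K := {i ∈ I | (#(reach G S W N (f i)) : ℝ) < θ}
  have hK : K.Nonempty := card_pos.1 (by have := hI.card_pos; lia)
  have hWK : (#W : ℝ) ≤ 4 * ℓ * #K :=
    calc (#W : ℝ) ≤ 2 * ℓ * #I := hW
      _ ≤ 2 * ℓ * (2 * #K) := by gcongr; exact_mod_cast hcard
      _ = 4 * ℓ * #K := by ring
  obtain ⟨v, hv, hvθ⟩ := hgrow _ (isSpread_image hD hℓ hQ hdeg hf hK hWK)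
  obtain ⟨i, hi, rfl⟩ := mem_image.1 hv
  exact (mem_filter.1 hi).2.not_ge hvθ

lemma exists_le_card_reach_and_le_card_reach {g : ι → V} (hD : 0 < D) (hℓ : 0 ≤ ℓ)
    (hQ : 8 * ℓ ≤ Q) (hdeg : ∀ v, D * Q ≤ #(G.neighborFinset v ∩ S))
    (hgrow : ∀ X, IsSpread G Q ℓ X W → ∃ x ∈ X, θ ≤ #(reach G S W N x))
    (hf : ∀ v ∈ S, ({i | G.Adj v (f i)}.ncard : ℝ) ≤ D)
    (hg : ∀ v ∈ S, ({i | G.Adj v (g i)}.ncard : ℝ) ≤ D) {I : Finset ι} (hI : I.Nonempty)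
    (hW : (#W : ℝ) ≤ 2 * ℓ * #I) :
    ∃ i ∈ I, θ ≤ #(reach G S W N (f i)) ∧ θ ≤ #(reach G S W N (g i)) := by
  classical
  by_contra! h
  have hcover : I ⊆ {i ∈ I | (#(reach G S W N (f i)) : ℝ) < θ} ∪
      {i ∈ I | (#(reach G S W N (g i)) : ℝ) < θ} := fun i hi ↦ by
    by_cases hfi : θ ≤ #(reach G S W N (f i))
    · exact mem_union_right _ (mem_filter.2 ⟨hi, h i hi hfi⟩)
    · exact mem_union_left _ (mem_filter.2 ⟨hi, not_le.1 hfi⟩)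
  have := (card_le_card hcover).trans (card_union_le _ _)
  have := two_mul_card_filter_reach_lt hD hℓ hQ hdeg hgrow hf hI hW
  have := two_mul_card_filter_reach_lt hD hℓ hQ hdeg hgrow hg hI hW
  lia

lemma isConnecting_union (hD : 0 < D) (hQ : 8 * Real.logb 2 (Fintype.card V) ^ 6 ≤ Q)
    (hN : 2 * (N : ℝ) + 2 ≤ Real.logb 2 (Fintype.card V) ^ 6)
    (hdeg : ∀ v, D * Q ≤ #(G.neighborFinset v ∩ S))
    (hgrow : ∀ X W, IsSpread G Q (Real.logb 2 (Fintype.card V) ^ 6) X W →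
      ∃ x ∈ X, θ ≤ #(reach G S W N x))
    (hjoin : ∀ W : Finset V, #W * Q ≤ 8 * Real.logb 2 (Fintype.card V) ^ 6 * Fintype.card V →
      ∀ x y, θ ≤ #(reach G S W N x) → θ ≤ #(reach G S W N y) →
        ¬ Disjoint (reach G S W N x ∩ reach G S W N y) T) :
    IsConnecting G D (S ∪ T : Finset V) := by
  intro r x y _ _ hxy
  set ℓ := Real.logb 2 (Fintype.card V) ^ 6
  have hℓ : 0 ≤ ℓ := by positivity
  have hxyS v (hv : v ∈ S) := hxy v (mem_coe.2 (mem_union_left _ hv))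
  have hx v (hv : v ∈ S) : ({i | G.Adj v (x i)}.ncard : ℝ) ≤ D :=
    le_trans (by exact_mod_cast Nat.le_add_right _ _) (hxyS v hv)
  have hy v (hv : v ∈ S) : ({i | G.Adj v (y i)}.ncard : ℝ) ≤ D :=
    le_trans (by exact_mod_cast Nat.le_add_left _ _) (hxyS v hv)
  refine exists_isPath_pairwise_disjoint_internalVertices hℓ fun I hI W hW ↦ ?_
  obtain ⟨i, hi, hix, hiy⟩ := exists_le_card_reach_and_le_card_reach hD hℓ hQ hdeg
    (fun X ↦ hgrow X W) hx hy hI hW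
  have hWn : (#W : ℝ) * Q ≤ 8 * ℓ * Fintype.card V := by
    have hspread : IsSpread G Q ℓ (I.image x) W :=
      isSpread_image hD hℓ hQ hdeg hx hI (hW.trans (by gcongr; norm_num))
    refine hspread.card_avoided_mul_le.trans ?_
    gcongr
    exact card_le_univ _
  obtain ⟨z, hz, hzT⟩ := not_disjoint_iff.1 (hjoin W hWn _ _ hix hiy)
  rw [mem_inter] at hz
  obtain ⟨P, hP, hlen, hint⟩ := exists_isPath_of_mem_reach hzT hz.1 hz.2
  exact ⟨i, hi, P, hP, hint, le_trans (by exact_mod_cast hlen) hN⟩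

end Reach

/-! ### The choice of parameters -/

section Parameters

lemma exists_one_sub_pow_eq {p : ℝ} (hp : p ∈ Set.Icc (0 : ℝ) 1) {N : ℕ} (hN : N ≠ 0) :
    ∃ q ∈ Set.Icc (0 : ℝ) 1, p ≤ N * q ∧ 1 - (1 - q) ^ N = p := by
  have hp' : 0 ≤ 1 - p := sub_nonneg.2 hp.2
  set r := (1 - p) ^ (N⁻¹ : ℝ)
  have hr0 : 0 ≤ r := Real.rpow_nonneg hp' _
  have hr1 : r ≤ 1 := Real.rpow_le_one hp' (by linarith [hp.1]) (by positivity)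
  have hrN : r ^ N = 1 - p := Real.rpow_inv_natCast_pow hp' hN
  refine ⟨1 - r, ⟨by linarith, by linarith⟩, ?_, by rw [sub_sub_cancel, hrN, sub_sub_cancel]⟩
  have bernoulli := one_add_mul_le_pow (a := r - 1) (by linarith) N
  rw [add_sub_cancel, hrN] at bernoulli
  linarith

lemma le_one_add_pow_of_log_le {x γ : ℝ} {L : ℕ} (hx : 0 < x) (hγ0 : 0 ≤ γ) (hγ1 : γ ≤ 1)
    (h : Real.log x ≤ L * (γ / 2)) : x ≤ (1 + γ) ^ L := by
  have hγ : γ / 2 ≤ Real.log (1 + γ) := by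
    refine le_trans ?_ (Real.le_log_one_add_of_nonneg hγ0)
    rw [le_div_iff₀ (by linarith)]
    nlinarith
  rw [← Real.log_le_log_iff hx (by positivity), Real.log_pow]
  exact h.trans (by gcongr)

lemma log_le_logb_two {x : ℝ} (hx : 1 ≤ x) : Real.log x ≤ Real.logb 2 x := by
  rw [Real.logb, le_div_iff₀ (Real.log_pos (by norm_num))]
  exact mul_le_of_le_one_right (Real.log_nonneg hx) (by linarith [Real.log_two_lt_d9])

lemma exp_neg_le_inv_sq_pow {x y : ℝ} (hx : 1 ≤ x) (k : ℕ) (h : 2 * Real.logb 2 x * k ≤ y) :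
    Real.exp (-y) ≤ (x ^ 2)⁻¹ ^ k := by
  have hpow : (x ^ 2)⁻¹ ^ k = Real.exp (-(2 * Real.log x * k)) := by
    rw [inv_pow, ← pow_mul, Real.exp_neg, ← Real.exp_log (pow_pos (by linarith) (2 * k)),
      Real.log_pow]
    congr 2
    push_cast
    ring
  rw [hpow]
  refine Real.exp_le_exp.2 (neg_le_neg (le_trans ?_ h))
  gcongr
  exact log_le_logb_two hx

lemma exists_phase_lengths {n : ℕ} {ε : ℝ} (hε0 : 0 < ε) (hε1 : ε ≤ 1)
    (hl : 1024 ≤ ε * Real.logb 2 n) :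
    ∃ L J : ℕ, 16 * Real.logb 2 n ^ 3 / ε ≤ L ∧ n ≤ 2 ^ J ∧ 0 < L * (J + 1) ∧
      ((L * (J + 1) : ℕ) : ℝ) + 1 ≤ Real.logb 2 n ^ 5 := by
  have hl1 : 1024 ≤ Real.logb 2 n := by
    have hl0 : 0 < Real.logb 2 n := pos_of_mul_pos_right (by linarith) hε0.le
    exact hl.trans (mul_le_of_le_one_left hl0.le hε1)
  have hJ : n ≤ 2 ^ ⌈Real.logb 2 n⌉₊ := by
    have := Real.natCeil_logb_natCast 2 n
    push_cast at this
    exact this ▸ Nat.le_pow_clog (by norm_num) n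
  set l := Real.logb 2 n
  have hl3 : 1 ≤ l ^ 3 / ε := by
    rw [one_le_div hε0]
    exact hε1.trans (one_le_pow₀ (by linarith))
  have hL : (⌈16 * l ^ 3 / ε⌉₊ : ℝ) ≤ 17 * (l ^ 3 / ε) := by
    linarith [Nat.ceil_lt_add_one (show 0 ≤ 16 * l ^ 3 / ε by positivity),
      mul_div_assoc 16 (l ^ 3) ε]
  refine ⟨⌈16 * l ^ 3 / ε⌉₊, ⌈l⌉₊, Nat.le_ceil _, hJ, by positivity, ?_⟩
  push_cast
  calc (⌈16 * l ^ 3 / ε⌉₊ : ℝ) * (⌈l⌉₊ + 1) + 1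
      ≤ 17 * (l ^ 3 / ε) * (2 * l) + l ^ 3 / ε * l := by
        gcongr
        · linarith [Nat.ceil_lt_add_one (show 0 ≤ l by linarith)]
        · exact one_le_mul_of_one_le_of_one_le hl3 (by linarith)
    _ = 35 * (l ^ 4 / ε) := by ring
    _ ≤ ε * l * (l ^ 4 / ε) := by gcongr; linarith
    _ = l ^ 5 := by field_simp

/-- The numerical constraints on the expansion parameters `ε` and `s`, the logarithm `l` of the
number of vertices, the maximum degree `Δ`, the density `p` of the random set and the density `q`
of the at most `l ^ 5` independent random sets of which it is the union. -/
structure IsAdmissible (ε l p q s Δ : ℝ) : Prop where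
  ε_pos : 0 < ε
  ε_le_one : ε ≤ 1
  le_ε_mul_l : 1024 ≤ ε * l
  p_pos : 0 < p
  p_le_one : p ≤ 1
  q_le_one : q ≤ 1
  p_le : p ≤ l ^ 5 * q
  le_p_mul_s : l ^ 10 ≤ p * s
  s_le : s ≤ Δ

/-- The value of the parameter `Q` of `IsSpread`, chosen so that its product with the bound
`p ^ 2 * s * δ / (Δ * l ^ 20)` on the degree into the terminals is `p * δ / 8`, a lower bound for
the degree of every vertex into the random set. -/
noncomputable def spread (l p s Δ : ℝ) : ℝ := Δ * l ^ 20 / (8 * p * s)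

namespace IsAdmissible

variable {ε l p q s Δ : ℝ}

lemma le_l (h : IsAdmissible ε l p q s Δ) : 1024 ≤ l :=
  h.le_ε_mul_l.trans (mul_le_of_le_one_left
    (pos_of_mul_pos_right (by linarith [h.le_ε_mul_l]) h.ε_pos.le).le h.ε_le_one)

lemma l_pos (h : IsAdmissible ε l p q s Δ) : 0 < l := by linarith [h.le_l]

lemma q_pos (h : IsAdmissible ε l p q s Δ) : 0 < q :=
  pos_of_mul_pos_right (h.p_pos.trans_le h.p_le) (pow_pos h.l_pos 5).le

lemma s_pos (h : IsAdmissible ε l p q s Δ) : 0 < s :=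
  pos_of_mul_pos_right ((pow_pos h.l_pos 10).trans_le h.le_p_mul_s) h.p_pos.le

lemma Δ_pos (h : IsAdmissible ε l p q s Δ) : 0 < Δ := h.s_pos.trans_le h.s_le

lemma le_l_pow (h : IsAdmissible ε l p q s Δ) {k : ℕ} (hk : k ≠ 0) : 1024 ≤ l ^ k :=
  h.le_l.trans (le_self_pow₀ (by linarith [h.le_l]) hk)

lemma pow_five_le_mul (h : IsAdmissible ε l p q s Δ) {x : ℝ} (hx : s ≤ x) : l ^ 5 ≤ q * x := by
  have := h.l_pos
  have := h.p_pos
  have := h.s_pos.trans_le hx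
  refine le_of_mul_le_mul_left (a := l ^ 5) ?_ (by positivity)
  calc l ^ 5 * l ^ 5 = l ^ 10 := by ring
    _ ≤ p * s := h.le_p_mul_s
    _ ≤ p * x := by gcongr
    _ ≤ l ^ 5 * q * x := by gcongr; exact h.p_le
    _ = l ^ 5 * (q * x) := by ring

lemma eight_mul_spread (h : IsAdmissible ε l p q s Δ) :
    8 * p * s * spread l p s Δ = Δ * l ^ 20 := by
  have := h.p_pos
  have := h.s_pos
  rw [spread]
  field_simp

lemma spread_pos (h : IsAdmissible ε l p q s Δ) : 0 < spread l p s Δ := by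
  have := h.l_pos
  have := h.p_pos
  have := h.s_pos
  have := h.Δ_pos
  unfold spread
  positivity

lemma pow_le_eight_mul_spread (h : IsAdmissible ε l p q s Δ) : l ^ 20 ≤ 8 * p * spread l p s Δ := by
  have := h.l_pos
  refine le_of_mul_le_mul_left (a := s) ?_ h.s_pos
  calc s * l ^ 20 ≤ Δ * l ^ 20 := by gcongr; exact h.s_le
    _ = s * (8 * p * spread l p s Δ) := by rw [← h.eight_mul_spread]; ring

lemma eight_mul_pow_six_le_spread (h : IsAdmissible ε l p q s Δ) : 8 * l ^ 6 ≤ spread l p s Δ := by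
  have := h.l_pos
  have := h.spread_pos
  suffices 64 * l ^ 6 ≤ 8 * spread l p s Δ by linarith
  calc 64 * l ^ 6 ≤ l ^ 14 * l ^ 6 := by gcongr; linarith [h.le_l_pow (k := 14) (by norm_num)]
    _ = l ^ 20 := by ring
    _ ≤ 8 * p * spread l p s Δ := h.pow_le_eight_mul_spread
    _ ≤ 8 * 1 * spread l p s Δ := by gcongr; exact h.p_le_one
    _ = 8 * spread l p s Δ := by ring

lemma maxDegree_mul_le (h : IsAdmissible ε l p q s Δ) {m w : ℝ} (hm : 0 ≤ m)
    (hw : w * spread l p s Δ ≤ 8 * l ^ 6 * m) :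
    Δ * w ≤ s * (m / 4) / 4 := by
  have := h.l_pos
  have := h.p_pos
  have := h.s_pos
  refine le_of_mul_le_mul_right (a := l ^ 20) ?_ (by positivity)
  calc Δ * w * l ^ 20 = 8 * p * s * (w * spread l p s Δ) := by
        rw [mul_right_comm, ← h.eight_mul_spread]
        ring
    _ ≤ 8 * p * s * (8 * l ^ 6 * m) := by gcongr
    _ ≤ 8 * 1 * s * (8 * l ^ 6 * m) := by gcongr; exact h.p_le_one
    _ = s * (m / 4) / 4 * (1024 * l ^ 6) := by ring
    _ ≤ s * (m / 4) / 4 * (l ^ 14 * l ^ 6) := by gcongr; exact h.le_l_pow (by norm_num)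
    _ = s * (m / 4) / 4 * l ^ 20 := by ring

lemma rate_pos (h : IsAdmissible ε l p q s Δ) : 0 < ε * q * s / (128 * Δ * l ^ 2) := by
  have := h.l_pos
  have := h.ε_pos
  have := h.q_pos
  have := h.s_pos
  have := h.Δ_pos
  positivity

lemma pow_twelve_le_rate_mul_spread (h : IsAdmissible ε l p q s Δ) :
    l ^ 12 ≤ ε * q * s / (128 * Δ * l ^ 2) * spread l p s Δ := by
  have := h.l_pos
  have := h.p_pos
  have := h.q_pos
  have := h.s_pos
  have := h.Δ_pos
  have hrate : ε * q * s / (128 * Δ * l ^ 2) * spread l p s Δ = ε * q * l ^ 18 / (1024 * p) := by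
    rw [spread]
    field_simp
    ring
  rw [hrate, le_div_iff₀ (by positivity)]
  calc l ^ 12 * (1024 * p) ≤ l ^ 12 * (ε * l * (l ^ 5 * q)) := by
        have := h.ε_pos
        gcongr
        exacts [h.le_ε_mul_l, h.p_le]
    _ = ε * q * l ^ 18 := by ring

lemma mul_add_le_rate_mul (h : IsAdmissible ε l p q s Δ) {x w m : ℝ} (hx : 0 ≤ x) (hw : 0 ≤ w)
    (hxm : x * spread l p s Δ ≤ 2 * m) (hwm : w * spread l p s Δ ≤ 8 * l ^ 6 * m) :
    5 * l ^ 5 * (x + w) ≤ ε * q * s / (128 * Δ * l ^ 2) * (m / 4) := by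
  have hl := h.l_pos
  set c := ε * q * s / (128 * Δ * l ^ 2)
  have hc : 0 < c := h.rate_pos
  have hl6 : 320 * l ^ 5 ≤ l ^ 6 := by
    rw [pow_succ' l 5]
    gcongr
    linarith [h.le_l]
  have hl12 : 80 * l ^ 5 ≤ l ^ 12 :=
    calc 80 * l ^ 5 ≤ l ^ 7 * l ^ 5 := by gcongr; linarith [h.le_l_pow (k := 7) (by norm_num)]
      _ = l ^ 12 := by ring
  have hx' : 80 * l ^ 5 * x ≤ 2 * (c * m) :=
    calc 80 * l ^ 5 * x ≤ c * spread l p s Δ * x := by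
          gcongr ?_ * _
          exact hl12.trans h.pow_twelve_le_rate_mul_spread
      _ = c * (x * spread l p s Δ) := by ring
      _ ≤ c * (2 * m) := by gcongr
      _ = 2 * (c * m) := by ring
  have hw' : 320 * l ^ 5 * w ≤ 8 * (c * m) := by
    refine le_of_mul_le_mul_left (a := l ^ 6) ?_ (by positivity)
    calc l ^ 6 * (320 * l ^ 5 * w) ≤ l ^ 6 * (l ^ 6 * w) := by gcongr
      _ = l ^ 12 * w := by ring
      _ ≤ c * spread l p s Δ * w := by gcongr; exact h.pow_twelve_le_rate_mul_spread
      _ = c * (w * spread l p s Δ) := by ring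
      _ ≤ c * (8 * l ^ 6 * m) := by gcongr
      _ = l ^ 6 * (8 * (c * m)) := by ring
  linarith

lemma two_mul_le_mul_card (h : IsAdmissible ε l p q s Δ) {n w : ℝ} (hsn : s ≤ n)
    (hw : w * spread l p s Δ ≤ 8 * l ^ 6 * n) :
    2 * l * (2 + w) ≤ q * (n / 5) := by
  have hl := h.l_pos
  have hp := h.p_pos
  have hqn : 40 * l ≤ q * n :=
    calc 40 * l ≤ l ^ 4 * l := by gcongr; linarith [h.le_l_pow (k := 4) (by norm_num)]
      _ = l ^ 5 := by ring
      _ ≤ q * n := h.pow_five_le_mul hsn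
  have hn : 0 < n := h.s_pos.trans_le hsn
  have hqw : 20 * l * w ≤ q * n := by
    obtain hw0 | hw0 := le_total w 0
    · linarith [mul_nonpos_of_nonneg_of_nonpos hl.le hw0]
    refine le_of_mul_le_mul_left (a := 64 * l ^ 11) ?_ (by positivity)
    calc 64 * l ^ 11 * (20 * l * w) = 1280 * l ^ 12 * w := by ring
      _ ≤ l ^ 8 * l ^ 12 * w := by
        gcongr
        calc (1280 : ℝ) ≤ 1024 * 1024 := by norm_num
          _ ≤ l ^ 4 * l ^ 4 := by gcongr <;> exact h.le_l_pow (by norm_num)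
          _ = l ^ 8 := by ring
      _ = l ^ 20 * w := by ring
      _ ≤ 8 * p * spread l p s Δ * w := by gcongr; exact h.pow_le_eight_mul_spread
      _ = 8 * p * (w * spread l p s Δ) := by ring
      _ ≤ 8 * p * (8 * l ^ 6 * n) := by gcongr
      _ ≤ 8 * (l ^ 5 * q) * (8 * l ^ 6 * n) := by gcongr; exact h.p_le
      _ = 64 * l ^ 11 * (q * n) := by ring
  linarith

end IsAdmissible

end Parameters

/-! ### The three exceptional events -/

section Events

lemma sum_pow_card_le_three {α : Type*} [Fintype α] {a : ℝ} (ha : 0 ≤ a)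
    (h : Fintype.card α * a ≤ 1) : ∑ W : Finset α, a ^ #W ≤ 3 := by
  calc ∑ W : Finset α, a ^ #W = (a + 1) ^ Fintype.card α := by
        simpa using Fintype.sum_pow_mul_eq_add_pow α a 1
    _ ≤ Real.exp a ^ Fintype.card α := by gcongr; exact Real.add_one_le_exp a
    _ = Real.exp (Fintype.card α * a) := (Real.exp_nat_mul _ _).symm
    _ ≤ Real.exp 1 := Real.exp_le_exp.2 h
    _ ≤ 3 := Real.exp_one_lt_three.le

lemma sum_inv_sq_pow_card_le_three (α : Type*) [Fintype α] :
    ∑ W : Finset α, ((Fintype.card α : ℝ) ^ 2)⁻¹ ^ #W ≤ 3 := by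
  refine sum_pow_card_le_three (by positivity) ?_
  obtain h | h := Nat.eq_zero_or_pos (Fintype.card α)
  · simp [h]
  · have hα : (1 : ℝ) ≤ Fintype.card α := by exact_mod_cast h
    rw [← div_eq_mul_inv, sq, div_self_mul_self']
    exact inv_le_one_of_one_le₀ hα

variable {V : Type*} [Fintype V]

lemma bernoulliProb_disjoint_le_exp {q : ℝ} (hq : q ≤ 1) (A : Finset V) :
    bernoulliProb q (fun T ↦ Disjoint A T) ≤ Real.exp (-(q * #A)) := by
  classical
  have hprob : bernoulliProb q (fun T ↦ Disjoint A T) = (1 - q) ^ #A := by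
    rw [← bernoulliExpect_disjoint q (subset_univ A), bernoulliProb]
    exact bernoulliExpect_congr fun T _ ↦ by congr
  rw [hprob, mul_comm, ← mul_neg, Real.exp_nat_mul]
  exact pow_le_pow_left₀ (sub_nonneg.2 hq) (Real.one_sub_le_exp_neg q) _

variable [DecidableEq V]

/-- Some spread pair `(X, W)` contains no vertex `x ∈ X` from which at least `θ` vertices can be
reached in `N` steps through `S`, avoiding `W`. -/
def GrowthFails (G : SimpleGraph V) [DecidableRel G.Adj] (Q ℓ θ : ℝ) (N : ℕ) (S : Finset V) :
    Prop :=
  ∃ XW : Finset V × Finset V,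
    IsSpread G Q ℓ XW.1 XW.2 ∧ ∀ x ∈ XW.1, (#(reach G S XW.2 N x) : ℝ) < θ

/-- Two vertices, from each of which at least `θ` vertices can be reached in `N` steps through `S`
avoiding a small set, have no common reachable vertex in `T`. The triple in the quantifier consists
of the avoided set and the two vertices. -/
def JoiningFails (G : SimpleGraph V) [DecidableRel G.Adj] (Q ℓ θ : ℝ) (N : ℕ) (S T : Finset V) :
    Prop :=
  ∃ w : Finset V × V × V,
    (#w.1 * Q ≤ 8 * ℓ * Fintype.card V ∧
      θ ≤ #(reach G S w.1 N w.2.1) ∧ θ ≤ #(reach G S w.1 N w.2.2)) ∧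
    Disjoint (reach G S w.1 N w.2.1 ∩ reach G S w.1 N w.2.2) T

variable {G : SimpleGraph V} [DecidableRel G.Adj] {ε p q s : ℝ} {L J : ℕ} {X W B : Finset V}

lemma bernoulliProb_exists_card_neighborFinset_inter_lt_le [Nonempty V]
    (hq : q ∈ Set.Icc (0 : ℝ) 1) (hpq : p ≤ 2 * q)
    (hδ : 16 * Real.logb 2 (Fintype.card V) ≤ p * G.minDegree) :
    bernoulliProb q (fun S ↦ ∃ v, (#(G.neighborFinset v ∩ S) : ℝ) < p * G.minDegree / 8) ≤
      1 / Fintype.card V := by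
  have hn : (1 : ℝ) ≤ Fintype.card V := by exact_mod_cast Fintype.card_pos (α := V)
  have hv (v : V) : bernoulliProb q
      (fun S ↦ (#(G.neighborFinset v ∩ S) : ℝ) < p * G.minDegree / 8) ≤
        ((Fintype.card V : ℝ) ^ 2)⁻¹ := by
    have hdeg : p / 4 * G.minDegree ≤ q / 2 * #(G.neighborFinset v) := by
      have := hq.1
      rw [G.card_neighborFinset_eq_degree]
      calc p / 4 * G.minDegree ≤ q / 2 * G.minDegree := by gcongr ?_ * _; linarith
        _ ≤ q / 2 * G.degree v := by gcongr; exact G.minDegree_le_degree v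
    refine (bernoulliProb_card_inter_lt_le hq _ _).trans ((Real.exp_le_exp.2 ?_).trans
      ((exp_neg_le_inv_sq_pow hn 1 le_rfl).trans_eq (pow_one _)))
    push_cast
    linarith
  calc bernoulliProb q (fun S ↦ ∃ v, (#(G.neighborFinset v ∩ S) : ℝ) < p * G.minDegree / 8)
      ≤ ∑ _ : V, ((Fintype.card V : ℝ) ^ 2)⁻¹ := bernoulliProb_exists_le_sum hq hv
    _ = 1 / Fintype.card V := by
      rw [sum_const, card_univ, nsmul_eq_mul]
      field_simp

lemma IsExpander.bernoulliProb_card_iterate_grow_lt_le {b : ℝ} (hG : IsExpander G ε s)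
    (h : IsAdmissible ε (Real.logb 2 (Fintype.card V)) p q s G.maxDegree)
    (hn : 2 ≤ Fintype.card V) (hL : 16 * Real.logb 2 (Fintype.card V) ^ 3 / ε ≤ L) (hb : 0 < b)
    (hW : (G.maxDegree : ℝ) * #W ≤ s * b / 4) (hB : b ≤ #B) :
    bernoulliProb (1 - (1 - q) ^ L)
        (fun S ↦ (#((grow G S W)^[L] B) : ℝ) < 3 / 5 * Fintype.card V) ≤
      L * Real.exp (-(ε * q * s /
        (128 * G.maxDegree * Real.logb 2 (Fintype.card V) ^ 2) * b)) := by
  have hn' : (2 : ℝ) ≤ Fintype.card V := by exact_mod_cast hn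
  have hlog : Real.log (Fintype.card V) ≤ Real.logb 2 (Fintype.card V) :=
    log_le_logb_two (by linarith)
  have hstep (B : Finset V) (hbB : b ≤ #B) (hB : (#B : ℝ) ≤ 3 / 5 * Fintype.card V) :=
    hG.bernoulliProb_card_grow_lt_le (B := B) (W := W) h.ε_pos hn
      ((div_le_one (pow_pos h.l_pos 2)).2
        (h.ε_le_one.trans (by linarith [h.le_l_pow (k := 2) (by norm_num)])))
      h.q_pos h.q_le_one
      (by linarith [h.pow_five_le_mul le_rfl, h.le_l_pow (k := 5) (by norm_num)])
      hb hbB (by linarith) hW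
  set l := Real.logb 2 (Fintype.card V)
  have hl := h.l_pos
  have hε := h.ε_pos
  have hgrowth : (Fintype.card V : ℝ) ≤ (1 + ε / (8 * l ^ 2)) ^ L := by
    refine le_one_add_pow_of_log_le (by linarith) (by positivity) ?_ (hlog.trans ?_)
    · rw [div_le_one (by positivity)]
      linarith [h.ε_le_one, h.le_l_pow (k := 2) (by norm_num)]
    · calc l = 16 * l ^ 3 / ε * (ε / (8 * l ^ 2) / 2) := by field_simp; norm_num
        _ ≤ L * (ε / (8 * l ^ 2) / 2) := by gcongr
  refine (bernoulliProb_mono (one_sub_one_sub_pow_mem_Icc ⟨h.q_pos.le, h.q_le_one⟩ L)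
    fun S hS ↦ hS.trans_le (le_min le_rfl ?_)).trans
      (SublinearExpander.bernoulliProb_card_iterate_grow_lt_le ⟨h.q_pos.le, h.q_le_one⟩
        (γ := ε / (8 * l ^ 2)) (by positivity) (Real.exp_pos _).le hstep L hB)
  have hB1 : (1 : ℝ) ≤ #B := by exact_mod_cast hb.trans_le hB
  calc 3 / 5 * (Fintype.card V : ℝ) ≤ Fintype.card V := by linarith
    _ ≤ (1 + ε / (8 * l ^ 2)) ^ L * #B := hgrowth.trans (le_mul_of_one_le_right (by positivity) hB1)

lemma IsSpread.card_outerNeighbors_pos {Q ℓ : ℝ} (h : IsSpread G Q ℓ X W) (hQ : 0 < Q) :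
    0 < #(outerNeighbors G X W) := by
  have hX : (0 : ℝ) < #X := by exact_mod_cast h.nonempty.card_pos
  have : (0 : ℝ) < 2 * #(outerNeighbors G X W) := (mul_pos hX hQ).trans_le h.card_mul_le
  exact_mod_cast pos_of_mul_pos_right this zero_le_two

lemma IsExpander.bernoulliProb_forall_card_reach_lt_le (hG : IsExpander G ε s)
    (h : IsAdmissible ε (Real.logb 2 (Fintype.card V)) p q s G.maxDegree)
    (hn : 2 ≤ Fintype.card V) (hL : 16 * Real.logb 2 (Fintype.card V) ^ 3 / ε ≤ L)
    (hJ : Fintype.card V ≤ 2 ^ J)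
    (hN : ((L * (J + 1) : ℕ) : ℝ) + 1 ≤ Real.logb 2 (Fintype.card V) ^ 5)
    (hXW : IsSpread G (spread (Real.logb 2 (Fintype.card V)) p s G.maxDegree)
      (Real.logb 2 (Fintype.card V) ^ 6) X W) :
    bernoulliProb (1 - (1 - q) ^ (L * (J + 1)))
        (fun S ↦ ∀ x ∈ X, (#(reach G S W (L * (J + 1)) x) : ℝ) < 3 / 5 * Fintype.card V) ≤
      ((Fintype.card V : ℝ) ^ 2)⁻¹ ^ (1 + #X + #W) := by
  have hm : (0 : ℝ) < #(outerNeighbors G X W) := by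
    exact_mod_cast hXW.card_outerNeighbors_pos h.spread_pos
  have hmn : (#(outerNeighbors G X W) : ℝ) ≤ Fintype.card V := by exact_mod_cast card_le_univ _
  have hX : (1 : ℝ) ≤ #X := by exact_mod_cast hXW.nonempty.card_pos
  have hexponent := h.mul_add_le_rate_mul (Nat.cast_nonneg _) (Nat.cast_nonneg _)
    hXW.card_mul_le hXW.card_avoided_mul_le
  have hfamily := bernoulliProb_forall_card_iterate_grow_lt_le (G := G) (W := W)
    ⟨h.q_pos.le, h.q_le_one⟩ (by positivity) (b := #(outerNeighbors G X W) / 4)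
    (t := 3 / 5 * Fintype.card V) (by positivity) (by linarith)
    (fun B hB ↦ hG.bernoulliProb_card_iterate_grow_lt_le h hn hL (by positivity)
      (h.maxDegree_mul_le hm.le hXW.card_avoided_mul_le) hB)
    J (X := X) (B := fun x ↦ G.neighborFinset x \ W) ((card_le_univ X).trans hJ)
    (by rw [← outerNeighbors]; linarith)
  refine hfamily.trans ?_
  set l := Real.logb 2 (Fintype.card V)
  set c := ε * q * s / (128 * G.maxDegree * l ^ 2) * (#(outerNeighbors G X W) / 4)
  have hl5 : l ≤ l ^ 5 := le_self_pow₀ (by linarith [h.le_l]) (by norm_num)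
  calc ((J : ℝ) + 1) * (L * Real.exp (-c)) = ((L * (J + 1) : ℕ) : ℝ) * Real.exp (-c) := by
        push_cast
        ring
    _ ≤ Real.exp (l ^ 5) * Real.exp (-c) := by
        gcongr
        linarith [Real.add_one_le_exp (l ^ 5)]
    _ = Real.exp (-(c - l ^ 5)) := by rw [← Real.exp_add]; ring_nf
    _ ≤ ((Fintype.card V : ℝ) ^ 2)⁻¹ ^ (1 + #X + #W) := by
        refine exp_neg_le_inv_sq_pow (by exact_mod_cast one_le_two.trans hn) _ ?_
        push_cast
        nlinarith [h.l_pos, (Nat.cast_nonneg #W : (0 : ℝ) ≤ #W),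
          mul_le_mul_of_nonneg_right hl5 (by positivity : (0 : ℝ) ≤ #X + #W)]

lemma IsExpander.bernoulliProb_growthFails_le (hG : IsExpander G ε s)
    (h : IsAdmissible ε (Real.logb 2 (Fintype.card V)) p q s G.maxDegree)
    (hn : 2 ≤ Fintype.card V) (hL : 16 * Real.logb 2 (Fintype.card V) ^ 3 / ε ≤ L)
    (hJ : Fintype.card V ≤ 2 ^ J)
    (hN : ((L * (J + 1) : ℕ) : ℝ) + 1 ≤ Real.logb 2 (Fintype.card V) ^ 5) :
    bernoulliProb (1 - (1 - q) ^ (L * (J + 1)))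
        (GrowthFails G (spread (Real.logb 2 (Fintype.card V)) p s G.maxDegree)
          (Real.logb 2 (Fintype.card V) ^ 6) (3 / 5 * Fintype.card V) (L * (J + 1))) ≤
      9 / (Fintype.card V : ℝ) ^ 2 := by
  refine (bernoulliProb_exists_le_sum (one_sub_one_sub_pow_mem_Icc ⟨h.q_pos.le, h.q_le_one⟩ _)
    (c := fun XW : Finset V × Finset V ↦ ((Fintype.card V : ℝ) ^ 2)⁻¹ ^ (1 + #XW.1 + #XW.2))
    fun XW ↦
      bernoulliProb_and_le (by positivity)
        (hG.bernoulliProb_forall_card_reach_lt_le h hn hL hJ hN)).trans ?_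
  have hsum := sum_inv_sq_pow_card_le_three V
  set a := ((Fintype.card V : ℝ) ^ 2)⁻¹
  calc ∑ XW : Finset V × Finset V, a ^ (1 + #XW.1 + #XW.2)
      = a * ((∑ X : Finset V, a ^ #X) * ∑ W : Finset V, a ^ #W) := by
        simp only [Fintype.sum_prod_type, pow_add, pow_one, mul_assoc, ← mul_sum, ← sum_mul]
    _ ≤ a * (3 * 3) := by gcongr
    _ = 9 / (Fintype.card V : ℝ) ^ 2 := by ring

lemma card_div_five_le_card_inter {A B : Finset V} (hA : 3 / 5 * (Fintype.card V : ℝ) ≤ #A)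
    (hB : 3 / 5 * (Fintype.card V : ℝ) ≤ #B) : (Fintype.card V : ℝ) / 5 ≤ #(A ∩ B) := by
  have hunion : (#(A ∪ B) : ℝ) + #(A ∩ B) = #A + #B := by
    exact_mod_cast card_union_add_card_inter A B
  have : (#(A ∪ B) : ℝ) ≤ Fintype.card V := by exact_mod_cast card_le_univ _
  linarith

lemma IsAdmissible.bernoulliProb_disjoint_inter_le
    (h : IsAdmissible ε (Real.logb 2 (Fintype.card V)) p q s G.maxDegree) [Nonempty V]
    (hW : #W * spread (Real.logb 2 (Fintype.card V)) p s G.maxDegree ≤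
      8 * Real.logb 2 (Fintype.card V) ^ 6 * Fintype.card V) {A B : Finset V}
    (hA : 3 / 5 * (Fintype.card V : ℝ) ≤ #A) (hB : 3 / 5 * (Fintype.card V : ℝ) ≤ #B) :
    bernoulliProb q (fun T ↦ Disjoint (A ∩ B) T) ≤ ((Fintype.card V : ℝ) ^ 2)⁻¹ ^ (2 + #W) := by
  have hsn : s ≤ Fintype.card V :=
    h.s_le.trans (by exact_mod_cast G.maxDegree_lt_card_verts.le)
  refine (bernoulliProb_disjoint_le_exp h.q_le_one _).trans
    (exp_neg_le_inv_sq_pow (by exact_mod_cast Fintype.card_pos (α := V)) _ ?_)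
  push_cast
  have := h.q_pos
  exact (h.two_mul_le_mul_card hsn hW).trans (by gcongr; exact card_div_five_le_card_inter hA hB)

lemma IsAdmissible.bernoulliProb_joiningFails_le
    (h : IsAdmissible ε (Real.logb 2 (Fintype.card V)) p q s G.maxDegree) [Nonempty V]
    (S : Finset V) (N : ℕ) :
    bernoulliProb q (JoiningFails G (spread (Real.logb 2 (Fintype.card V)) p s G.maxDegree)
        (Real.logb 2 (Fintype.card V) ^ 6) (3 / 5 * Fintype.card V) N S) ≤
      3 / (Fintype.card V : ℝ) ^ 2 := by
  refine (bernoulliProb_exists_le_sum ⟨h.q_pos.le, h.q_le_one⟩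
    (c := fun w ↦ ((Fintype.card V : ℝ) ^ 2)⁻¹ ^ (2 + #w.1)) fun w ↦
      bernoulliProb_and_le (by positivity) fun hw ↦
        h.bernoulliProb_disjoint_inter_le hw.1 hw.2.1 hw.2.2).trans ?_
  have hn : (Fintype.card V : ℝ) ≠ 0 := by exact_mod_cast Fintype.card_ne_zero
  have hsum := sum_inv_sq_pow_card_le_three V
  set a := ((Fintype.card V : ℝ) ^ 2)⁻¹
  calc ∑ w : Finset V × V × V, a ^ (2 + #w.1)
      = a ^ 2 * ((Fintype.card V : ℝ) ^ 2 * ∑ W : Finset V, a ^ #W) := by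
        simp only [Fintype.sum_prod_type, sum_const, card_univ, nsmul_eq_mul, pow_add, mul_sum,
          Fintype.card_prod, Nat.cast_mul]
        refine sum_congr rfl fun W _ ↦ ?_
        ring
    _ ≤ a ^ 2 * ((Fintype.card V : ℝ) ^ 2 * 3) := by gcongr
    _ = 3 / (Fintype.card V : ℝ) ^ 2 := by simp only [a]; field_simp [hn]

end Events

/-! ### Random sets are connecting -/

section Connecting

lemma le_two_mul_one_sub_one_sub_pow {q : ℝ} (hq : q ∈ Set.Icc (0 : ℝ) 1) {k : ℕ} (hk : k ≠ 0) :
    1 - (1 - q) ^ (k + 1) ≤ 2 * (1 - (1 - q) ^ k) := by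
  have hpow : (1 - q) ^ k ≤ 1 - q := pow_le_of_le_one (sub_nonneg.2 hq.2) (by linarith [hq.1]) hk
  have : (1 - q) ^ k * q ≤ q := mul_le_of_le_one_left hq.1 (by linarith [hq.1])
  rw [pow_succ]
  linarith

lemma setBernoulli_real_eq_bernoulliProb {V : Type*} [Fintype V] (p : unitInterval)
    (P : Set V → Prop) :
    (ProbabilityTheory.setBernoulli (Set.univ : Set V) p).real {S | P S} =
      bernoulliProb (p : ℝ) (fun S : Finset V ↦ P S) := by
  classical
  have hatoms : {S : Set V | P S} =
      ⋃ S ∈ (univ.filter fun S : Finset V ↦ P S), {(S : Set V)} := by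
    ext S
    simp only [Set.mem_ofPred_eq, Set.mem_iUnion, Set.mem_singleton_iff, mem_filter, mem_univ,
      true_and, exists_prop]
    exact ⟨fun h ↦ ⟨S.toFinset, by simpa using h, by simp⟩, by rintro ⟨T, hT, rfl⟩; exact hT⟩
  rw [hatoms, MeasureTheory.measureReal_biUnion_finset (fun S _ T _ hST ↦ by simpa using hST)
    fun S _ ↦ .singleton _, sum_filter, bernoulliProb, bernoulliExpect, powerset_univ]
  refine sum_congr rfl fun S _ ↦ ?_
  have hcompl : ((Set.univ : Set V) \ S).ncard = #(univ : Finset V) - #S := by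
    rw [← coe_univ, ← coe_sdiff, Set.ncard_coe_finset, card_sdiff_of_subset (subset_univ _)]
  rw [ProbabilityTheory.setBernoulli_real_singleton p (Set.subset_univ _) Set.finite_univ, hcompl,
    Set.ncard_coe_finset]
  by_cases h : P S <;> simp [h]

variable {V : Type*} [Fintype V] {G : SimpleGraph V} {ε p q s : ℝ}

lemma IsExpander.anti {ε' : ℝ} (hG : IsExpander G ε s) (hε : ε' ≤ ε) : IsExpander G ε' s := by
  intro U F hF hU hU' hFU
  refine le_trans ?_ (hG U F hF hU hU' hFU)
  gcongr

lemma IsConnecting.anti {D D' : ℝ} {S : Set V} (h : IsConnecting G D S) (hD : D' ≤ D) :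
    IsConnecting G D' S :=
  fun r x y hx hy hdeg ↦ h r x y hx hy fun v hv ↦ (hdeg v hv).trans hD

variable [DecidableRel G.Adj]

lemma IsExpander.lt_minDegree (hG : IsExpander G ε s) (hε : 0 < ε) (hn : 2 ≤ Fintype.card V) :
    s < G.minDegree := by
  classical
  have : Nonempty V := Fintype.card_pos_iff.1 (by lia)
  obtain ⟨v, hv⟩ := G.exists_minimal_degree_vertex
  exact hv ▸ hG.lt_degree hε hn v

lemma IsExpander.isAdmissible (hG : IsExpander G ε s) (hε : 0 < ε) (hε1 : ε ≤ 1)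
    (hl : 1024 ≤ ε * Real.logb 2 (Fintype.card V)) (hn : 2 ≤ Fintype.card V)
    (hp : 0 < p) (hp1 : p ≤ 1) (hq : q ≤ 1)
    (hpq : p ≤ Real.logb 2 (Fintype.card V) ^ 5 * q)
    (hs : p⁻¹ * Real.logb 2 (Fintype.card V) ^ 10 ≤ s) :
    IsAdmissible ε (Real.logb 2 (Fintype.card V)) p q s G.maxDegree where
  ε_pos := hε
  ε_le_one := hε1
  le_ε_mul_l := hl
  p_pos := hp
  p_le_one := hp1
  q_le_one := hq
  p_le := hpq
  le_p_mul_s := (inv_mul_le_iff₀ hp).1 hs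
  s_le := hG.le_maxDegree hε hn

lemma IsAdmissible.mul_spread {l δ Δ : ℝ} (h : IsAdmissible ε l p q s Δ) :
    p ^ 2 * s * δ / (Δ * l ^ 20) * spread l p s Δ = p * δ / 8 := by
  have := h.l_pos
  have := h.p_pos
  have := h.s_pos
  have := h.Δ_pos
  rw [spread]
  field_simp

lemma IsAdmissible.isConnecting_union [DecidableEq V] {S T : Finset V} {N : ℕ}
    (h : IsAdmissible ε (Real.logb 2 (Fintype.card V)) p q s G.maxDegree) (hδ : 0 < G.minDegree)
    (hN : (N : ℝ) + 1 ≤ Real.logb 2 (Fintype.card V) ^ 5)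
    (hdeg : ¬ ∃ v, (#(G.neighborFinset v ∩ S) : ℝ) < p * G.minDegree / 8)
    (hgrow : ¬ GrowthFails G (spread (Real.logb 2 (Fintype.card V)) p s G.maxDegree)
      (Real.logb 2 (Fintype.card V) ^ 6) (3 / 5 * Fintype.card V) N S)
    (hjoin : ¬ JoiningFails G (spread (Real.logb 2 (Fintype.card V)) p s G.maxDegree)
      (Real.logb 2 (Fintype.card V) ^ 6) (3 / 5 * Fintype.card V) N S T) :
    IsConnecting G
      (p ^ 2 * s * G.minDegree / (G.maxDegree * Real.logb 2 (Fintype.card V) ^ 20))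
      (S ∪ T : Finset V) := by
  unfold GrowthFails at hgrow
  push Not at hdeg hgrow
  have : (0 : ℝ) < G.minDegree := by exact_mod_cast hδ
  refine SublinearExpander.isConnecting_union ?_ h.eight_mul_pow_six_le_spread ?_
    (fun v ↦ h.mul_spread.trans_le (hdeg v)) (fun X W hXW ↦ hgrow (X, W) hXW)
    fun W hW x y hx hy hdisj ↦ hjoin ⟨(W, x, y), ⟨hW, hx, hy⟩, hdisj⟩
  · have := h.l_pos
    have := h.p_pos
    have := h.s_pos
    have := h.Δ_pos
    positivity
  · calc 2 * (N : ℝ) + 2 = 2 * (N + 1) := by ring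
      _ ≤ Real.logb 2 (Fintype.card V) * Real.logb 2 (Fintype.card V) ^ 5 :=
        mul_le_mul (by linarith [h.le_l]) hN (by positivity) h.l_pos.le
      _ = Real.logb 2 (Fintype.card V) ^ 6 := by ring

lemma IsExpander.bernoulliProb_not_isConnecting_le_of_isAdmissible {L J : ℕ}
    (hG : IsExpander G ε s)
    (h : IsAdmissible ε (Real.logb 2 (Fintype.card V)) p q s G.maxDegree)
    (hn : 2 ≤ Fintype.card V) (hL : 16 * Real.logb 2 (Fintype.card V) ^ 3 / ε ≤ L)
    (hJ : Fintype.card V ≤ 2 ^ J) (hN₀ : L * (J + 1) ≠ 0)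
    (hN : ((L * (J + 1) : ℕ) : ℝ) + 1 ≤ Real.logb 2 (Fintype.card V) ^ 5)
    (hqp : 1 - (1 - q) ^ (L * (J + 1) + 1) = p)
    (hδ : 16 * Real.logb 2 (Fintype.card V) ≤ p * G.minDegree) :
    bernoulliProb p (fun S : Finset V ↦ ¬ IsConnecting G
        (p ^ 2 * s * G.minDegree / (G.maxDegree * Real.logb 2 (Fintype.card V) ^ 20)) S) ≤
      13 / Fintype.card V := by
  classical
  have : Nonempty V := Fintype.card_pos_iff.1 (by lia)
  have hq : q ∈ Set.Icc (0 : ℝ) 1 := ⟨h.q_pos.le, h.q_le_one⟩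
  have hq' := one_sub_one_sub_pow_mem_Icc hq (L * (J + 1))
  have hδpos : 0 < G.minDegree := by exact_mod_cast h.s_pos.trans (hG.lt_minDegree h.ε_pos hn)
  have hdeg := bernoulliProb_exists_card_neighborFinset_inter_lt_le hq'
    (hqp ▸ le_two_mul_one_sub_one_sub_pow hq hN₀) hδ
  have hgrow := hG.bernoulliProb_growthFails_le h hn hL hJ hN
  have hunion := bernoulliProb_union_pow_le hq (L * (J + 1)) 1
    (c := 3 / (Fintype.card V : ℝ) ^ 2) (by positivity)
    (P := fun S ↦ (∃ v, (#(G.neighborFinset v ∩ S) : ℝ) < p * G.minDegree / 8) ∨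
      GrowthFails G (spread (Real.logb 2 (Fintype.card V)) p s G.maxDegree)
        (Real.logb 2 (Fintype.card V) ^ 6) (3 / 5 * Fintype.card V) (L * (J + 1)) S)
    (R := fun S : Finset V ↦ ¬ IsConnecting G
      (p ^ 2 * s * G.minDegree / (G.maxDegree * Real.logb 2 (Fintype.card V) ^ 20)) S)
    (fun S T hconn ↦ or_iff_not_imp_left.2 fun hS ↦ not_not.1 fun hjoin ↦ hconn
      (h.isConnecting_union hδpos hN (not_or.1 hS).1 (not_or.1 hS).2 hjoin))
    fun S _ ↦ by simpa using h.bernoulliProb_joiningFails_le S (L * (J + 1))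
  rw [hqp] at hunion
  have hn_sq : (Fintype.card V : ℝ) ≤ Fintype.card V ^ 2 :=
    le_self_pow₀ (by exact_mod_cast one_le_two.trans hn) two_ne_zero
  calc _ ≤ _ := hunion
    _ ≤ 1 / Fintype.card V + 9 / (Fintype.card V : ℝ) ^ 2 + 3 / (Fintype.card V : ℝ) ^ 2 := by
      gcongr
      exact (bernoulliProb_or_le hq' _ _).trans (add_le_add hdeg hgrow)
    _ ≤ 1 / Fintype.card V + 9 / Fintype.card V + 3 / Fintype.card V := by gcongr
    _ = 13 / Fintype.card V := by ring

lemma IsExpander.bernoulliProb_not_isConnecting_le (hG : IsExpander G ε s) (hε : 0 < ε)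
    (hε1 : ε ≤ 1) (hl : 1024 ≤ ε * Real.logb 2 (Fintype.card V)) (hp : p ∈ Set.Icc (0 : ℝ) 1)
    (hδ : 16 * Real.logb 2 (Fintype.card V) / G.minDegree ≤ p)
    (hs : p⁻¹ * Real.logb 2 (Fintype.card V) ^ 10 ≤ s) :
    bernoulliProb p (fun S : Finset V ↦ ¬ IsConnecting G
        (p ^ 2 * s * G.minDegree / (G.maxDegree * Real.logb 2 (Fintype.card V) ^ 20)) S) ≤
      13 / Fintype.card V := by
  have hlpos : 0 < Real.logb 2 (Fintype.card V) := pos_of_mul_pos_right (by linarith) hε.le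
  have hn : 2 ≤ Fintype.card V := by
    by_contra! hn
    interval_cases Fintype.card V <;> simp at hlpos
  have hs₀ : 0 ≤ s := (mul_nonneg (inv_nonneg.2 hp.1) (pow_nonneg hlpos.le _)).trans hs
  have hδpos : (0 : ℝ) < G.minDegree := hs₀.trans_lt (hG.lt_minDegree hε hn)
  have hp₀ : 0 < p := (div_pos (mul_pos (by norm_num) hlpos) hδpos).trans_le hδ
  obtain ⟨L, J, hL, hJ, hN₀, hN⟩ := exists_phase_lengths hε hε1 hl
  obtain ⟨q, hq, hpq, hqp⟩ := exists_one_sub_pow_eq hp (L * (J + 1)).succ_ne_zero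
  have hadm := hG.isAdmissible hε hε1 hl hn hp₀ hp.2 hq.2
    (hpq.trans (mul_le_mul_of_nonneg_right (by exact_mod_cast hN) hq.1)) hs
  exact hG.bernoulliProb_not_isConnecting_le_of_isAdmissible hadm hn hL hJ hN₀.ne' hN hqp
    ((div_le_iff₀ hδpos).1 hδ)

lemma inv_mul_pow_ten_le {l : ℝ} (hp : p ∈ Set.Icc (0 : ℝ) 1) (hl : l = 0 ∨ 1 ≤ l) :
    p⁻¹ * l ^ 10 ≤ (p ^ 4)⁻¹ * l ^ 30 := by
  rw [← inv_pow]
  obtain ⟨hp₀, hp₁⟩ := hp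
  obtain rfl | hl := hl
  · simp
  obtain rfl | hp₀ := hp₀.eq_or_lt
  · simp
  gcongr
  · exact le_self_pow₀ ((one_le_inv₀ hp₀).2 hp₁) (by norm_num)
  · norm_num

lemma pow_nine_mul_div_le {l δ Δ : ℝ} (hp : p ∈ Set.Icc (0 : ℝ) 1) (hl : l = 0 ∨ 1 ≤ l)
    (hs : 0 ≤ s) (hδ : 0 ≤ δ) (hΔ : 0 ≤ Δ) :
    p ^ 9 * s * δ / (Δ * l ^ 73) ≤ p ^ 2 * s * δ / (Δ * l ^ 20) := by
  obtain rfl | hl := hl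
  · simp
  obtain rfl | hΔ := hΔ.eq_or_lt
  · simp
  have hpow : p ^ 9 ≤ p ^ 2 := pow_le_pow_of_le_one hp.1 hp.2 (by norm_num)
  have := hp.1
  gcongr
  norm_num

lemma logb_two_natCast_eq_zero_or_one_le (n : ℕ) : Real.logb 2 n = 0 ∨ 1 ≤ Real.logb 2 n := by
  obtain hn | hn := lt_or_ge n 2
  · left
    interval_cases n <;> simp
  · right
    rw [Real.le_logb_iff_rpow_le one_lt_two (by positivity)]
    simpa using hn

end Connecting

end SublinearExpander

theorem mainTheorem4_general {ε : ℝ} (hε : 0 < ε) :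
    ∃ f : ℕ → ℝ, Filter.Tendsto f Filter.atTop (nhds 0) ∧
      ∀ (V : Type*) [Fintype V] (G : SimpleGraph V) [DecidableRel G.Adj] (s : ℝ)
        (p : unitInterval), SublinearExpander.IsExpander G ε s →
        16 * Real.logb 2 (Fintype.card V : ℝ) / (G.minDegree : ℝ) ≤ (p : ℝ) →
        (p : ℝ)⁻¹ * (Real.logb 2 (Fintype.card V : ℝ)) ^ 10 ≤ s →
        1 - f (Fintype.card V) ≤
          (ProbabilityTheory.setBernoulli (Set.univ : Set V) p).real
            {S : Set V | SublinearExpander.IsConnecting G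
              ((p : ℝ) ^ 2 * s * (G.minDegree : ℝ) /
                ((G.maxDegree : ℝ) * (Real.logb 2 (Fintype.card V : ℝ)) ^ 20)) S} := by
  refine ⟨fun n ↦ if 1024 ≤ min ε 1 * Real.logb 2 n then 13 / n else 1, ?_, ?_⟩
  · refine (tendsto_const_div_atTop_nhds_zero_nat (13 : ℝ)).congr' ?_
    have hlog := (((Real.tendsto_logb_atTop one_lt_two).comp
      tendsto_natCast_atTop_atTop).const_mul_atTop (lt_min hε one_pos)).eventually_ge_atTop 1024
    filter_upwards [hlog] with n hn using (if_pos hn).symm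
  · intro V _ G _ s p hG hδ hs
    dsimp only
    split_ifs with hl
    · have hfail := (hG.anti (min_le_left ε 1)).bernoulliProb_not_isConnecting_le
        (lt_min hε one_pos) (min_le_right ε 1) hl p.2 hδ hs
      rw [SublinearExpander.bernoulliProb_not] at hfail
      rw [SublinearExpander.setBernoulli_real_eq_bernoulliProb]
      linarith
    · simp

theorem mainTheorem4 :
    ∃ f : ℕ → ℝ, Filter.Tendsto f Filter.atTop (nhds 0) ∧
      ∀ (V : Type*) [Fintype V] (G : SimpleGraph V) [DecidableRel G.Adj]
        (ε s : ℝ) (p : unitInterval),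
        SublinearExpander.IsExpander G ε s →
        (2 : ℝ)⁻¹ ^ 90 < ε → ε < 1 →
        100 * Real.logb 2 (Fintype.card V : ℝ) / (G.minDegree : ℝ) ≤ (p : ℝ) →
        ((p : ℝ) ^ 4)⁻¹ * (Real.logb 2 (Fintype.card V : ℝ)) ^ 30 ≤ s →
        1 - f (Fintype.card V) ≤
          (ProbabilityTheory.setBernoulli (Set.univ : Set V) p).real
            {S : Set V | SublinearExpander.IsConnecting G
              ((p : ℝ) ^ 9 * s * (G.minDegree : ℝ) /
                ((G.maxDegree : ℝ) * (Real.logb 2 (Fintype.card V : ℝ)) ^ 73)) S} := by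
  obtain ⟨f, hf, hconn⟩ := mainTheorem4_general (ε := 2⁻¹ ^ 90) (by positivity)
  refine ⟨f, hf, fun V _ G _ ε s p hG hε _ hδ hs ↦ ?_⟩
  have hp : (p : ℝ) ∈ Set.Icc (0 : ℝ) 1 := p.2
  have hl := SublinearExpander.logb_two_natCast_eq_zero_or_one_le (Fintype.card V)
  have hl₀ : 0 ≤ Real.logb 2 (Fintype.card V) := hl.elim Eq.ge zero_le_one.trans
  have hs₀ : 0 ≤ s := le_trans (by positivity) hs
  refine (hconn V G s p (hG.anti hε.le) (le_trans (by gcongr; norm_num) hδ)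
    ((SublinearExpander.inv_mul_pow_ten_le hp hl).trans hs)).trans
      (MeasureTheory.measureReal_mono fun S hS ↦ hS.anti ?_)
  exact SublinearExpander.pow_nine_mul_div_le hp hl hs₀ (Nat.cast_nonneg _) (Nat.cast_nonneg _)
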